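/- Let $(R,\mathfrak m)$ be a one-dimensional, Noetherian, analytically unramified (i.e. the $\mathfrak m$-adic completion of $R$ is reduced), Cohen–Macaulay local ring with infinite residue field. Let $\overline R$ be the integral closure of $R$ in its total ring of fractions $Q(R)$, let $\mathfrak c=R:\overline R$ be the conductor, let $\nu$ be the embedding dimension of $R$ (the minimal number of generators of $\mathfrak m$), and let $\ell$ denote length of $R$-modules; here $I:J=\{q\in Q(R)\mid qJ\subseteq I\}$. A fractional ideal is a finitely generated $R$-submodule of $Q(R)$ containing a non-zero-divisor of $Q(R)$, and a canonical ideal is a fractional ideal $\omega$ such that $\omega:(\omega:J)=J$ for every fractional ideal $J$. Suppose that $R$ is almost Gorenstein in the sense of Barucci–Fröberg, i.e. $\omega\subseteq\mathfrak m:\mathfrak m$ for a canonical ideal $\omega$ with $R\subseteq\omega\subseteq\overline R$ (this does not depend on the choice of $\omega$). Then $\ell(R/\mathfrak c)$ and the Hilbert–Samuel multiplicity $e(\mathfrak c)=\lim_{n\to\infty}\ell(R/\mathfrak c^n)/n$ are finite (the latter is $0$ if $\mathfrak c=R$, and in every case it is a non-negative integer), and $$e(\mathfrak c)\le \nu\cdot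 \ell(R/\mathfrak c).$$ -/

import Mathlib

namespace WilfAG

open IsLocalRing

/-- A (Noetherian) local ring is Cohen-Macaulay if its depth equals its dimension: the maximal
ideal contains a regular sequence whose length is the Krull dimension of the ring. -/
def IsCohenMacaulayLocal (R : Type*) [CommRing R] [IsLocalRing R] : Prop :=
  ∃ rs : List R, (∀ r ∈ rs, r ∈ maximalIdeal R) ∧ RingTheory.Sequence.IsRegular R rs ∧
    ringKrullDim R = (rs.length : WithBot ℕ∞)

/-- A local ring is analytically unramified if its completion with respect to the maximal ideal
is reduced. -/
def IsAnalyticallyUnramified (R : Type*) [CommRing R] [IsLocalRing R] : Prop :=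
  IsReduced (AdicCompletion (maximalIdeal R) R)

/-- The integral closure of `R` in its total ring of fractions `Q(R)`, as an `R`-submodule of
`Q(R)`. Here `FractionRing R` is the localization of `R` at all its non-zero-divisors. -/
noncomputable def integralClosureInQ (R : Type*) [CommRing R] : Submodule R (FractionRing R) :=
  Subalgebra.toSubmodule (integralClosure R (FractionRing R))

/-- The conductor `R : R̄`, where `R̄` is the integral closure of `R` in `Q(R)`, as an ideal
of `R`. In Mathlib, `I / J` is `{q | q J ⊆ I}` for submodules `I`, `J` of `Q(R)`, and `1` is the
submodule `R`; since `1 ∈ R̄`, the submodule `R : R̄` is contained in `R`. -/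
noncomputable def conductorIdeal (R : Type*) [CommRing R] : Ideal R :=
  ((1 : Submodule R (FractionRing R)) / integralClosureInQ R).comap
    (Algebra.linearMap R (FractionRing R))

/-- A regular fractional ideal: an `R`-submodule `J` of `Q(R)` that has a common denominator which
is a non-zero-divisor of `R` (for `R` Noetherian: a finitely generated submodule), and that
contains a non-zero-divisor of `Q(R)`. -/
def IsRegularFractionalIdeal {R : Type*} [CommRing R] (J : Submodule R (FractionRing R)) : Prop :=
  IsFractional (nonZeroDivisors R) J ∧ ∃ q ∈ J, q ∈ nonZeroDivisors (FractionRing R)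

/-- A canonical ideal: a regular fractional ideal `ω` with `J = ω : (ω : J)` for every regular
fractional ideal `J`. -/
def IsCanonicalIdeal {R : Type*} [CommRing R] (ω : Submodule R (FractionRing R)) : Prop :=
  IsRegularFractionalIdeal ω ∧
    ∀ J : Submodule R (FractionRing R), IsRegularFractionalIdeal J → ω / (ω / J) = J

/-- The almost Gorenstein property (Barucci-Fröberg): `ω ⊆ 𝔪 : 𝔪` for a canonical ideal `ω`
with `R ⊆ ω ⊆ R̄`. -/
def IsAlmostGorenstein (R : Type*) [CommRing R] [IsLocalRing R] : Prop :=
  ∃ ω : Submodule R (FractionRing R), IsCanonicalIdeal ω ∧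
    1 ≤ ω ∧ ω ≤ integralClosureInQ R ∧
    ω ≤ IsLocalization.coeSubmodule (FractionRing R) (maximalIdeal R) /
      IsLocalization.coeSubmodule (FractionRing R) (maximalIdeal R)

/-- `e` is the Hilbert-Samuel multiplicity of the ideal `I` in a ring of Krull dimension `d`:
all `R ⧸ I ^ n` have finite length and `d! * length (R ⧸ I ^ n) / n ^ d` tends to `e`. -/
def IsHilbertSamuelMultiplicity {R : Type*} [CommRing R] (I : Ideal R) (e : ℕ) : Prop :=
  ∃ d : ℕ, ringKrullDim R = (d : WithBot ℕ∞) ∧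
    (∀ n : ℕ, Module.length R (R ⧸ I ^ n) ≠ ⊤) ∧
    Filter.Tendsto
      (fun n : ℕ => (d.factorial : ℝ) * ((Module.length R (R ⧸ I ^ n)).toNat : ℝ) / (n : ℝ) ^ d)
      Filter.atTop (nhds (e : ℝ))

/-- The embedding dimension of a (Noetherian) local ring: the minimal number of generators of its
maximal ideal. -/
noncomputable def embeddingDim (R : Type*) [CommRing R] [IsLocalRing R] : ℕ :=
  (maximalIdeal R).spanFinrank

end WilfAG

/-!
Write `T` for the normalization of `R`, `c = R : T` for the conductor, `ν` for the embedding
dimension, and put `n = ℓ(R / c)`, `τ = ℓ(ω / R)`.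

*Finiteness of `T`.* Let `x` be a non-zero-divisor in `𝔪`. Counting lengths as in the Krull–Akizuki
theorem gives a finitely generated `B ⊆ T` with `T = B + x T` (`exists_fg_sup_eq`). The completion
of `R` is a reduced Noetherian local ring of dimension at most one, and in its normalization only
`0` is divisible by all powers of `x` (`eq_zero_of_forall_integral_div`). Hence Nakayama's lemma
over the completion shows that `B` generates `T` there, and by faithful flatness a common
denominator of `B` is one of `T` (`isFractional_integralClosureInQ`).

*Ideals of `T`.* The `ω`-duality makes `c = ω : T` a canonical ideal of `T`, and since rings of
multipliers of `T`-ideals are `T`, all regular fractional `T`-ideals are invertible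
(`mul_integralClosureInQ_div`). As `T` is semilocal and the residue field is infinite, this gives
`y ∈ c` with `c = y T` and `x ∈ 𝔪` with `𝔪 T = x T` (`exists_mul_integralClosureInQ_eq`). The first
yields `ℓ(R / c ^ k) = k ℓ(T / c) - ℓ(T / R)`, so that `e(c) = ℓ(T / c)`
(`isHilbertSamuelMultiplicity_of_coeSubmodule_eq`).

*The inequality.* The map `I ↦ ω : I` reverses inclusions and preserves lengths, so
`ℓ(T / ω) = ℓ(R / c)` and `ℓ(T / c) = 2 n + τ`. If `c = 𝔪`, then `ℓ(T / c) = ν`. If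
`c ≠ 𝔪`, let `U = {w ∈ ω | x w ∈ c}`.

* Multiplication by `x` embeds `ω / (R + U)` into `𝔪 / (x R + c)`, which has length at most `n - 2`
  (`AlmostGorensteinFrame.relLength_sup_add_two_le`).
* By duality, `(R + U) / R` has the length of `ω / (ω ∩ (R + x T))`. Multiplication by `x` makes
  `ω / (ω ∩ x T)` a quotient of `(x ω + 𝔪 ^ 2) / 𝔪 ^ 2`, because `𝔪 ^ 2 ⊆ x ^ 2 T`; so it has length
  at most `ν`, and passing to `ω / (ω ∩ (R + x T))` loses at least one
  (`AlmostGorensteinFrame.relLength_one_sup_add_one_le`).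

Thus `τ ≤ n + ν - 3`, which gives `2 n + τ ≤ ν n` for `ν ≥ 3`. For `ν = 2` the ring is Gorenstein,
so `τ = 0` (`AlmostGorensteinFrame.omega_eq_one`), and for `ν ≤ 1` it is normal
(`AlmostGorensteinFrame.m_ne_X`).
-/

namespace WilfAG

open IsLocalRing nonZeroDivisors

/-! ### Relative length of submodules -/

section RelLength

variable {R M N : Type*} [CommRing R] [AddCommGroup M] [Module R M] [AddCommGroup N] [Module R N]

/-- The length of `I / J` for submodules `J ≤ I` of a common module (in general, of
`I / (J ⊓ I)`). -/
noncomputable def relLength (J I : Submodule R M) : ℕ∞ :=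
  Module.length R (I ⧸ J.comap I.subtype)

/-- The submodules of `I / J` are the submodules between `J` and `I`. -/
noncomputable def submoduleQuotientIso {J I : Submodule R M} (h : J ≤ I) :
    Submodule R (I ⧸ J.comap I.subtype) ≃o Set.Icc J I :=
  (Submodule.comapMkQRelIso (J.comap I.subtype)).trans
    { toFun := fun p => ⟨p.1.map I.subtype, by
        constructor
        · have := Submodule.map_mono (f := I.subtype) p.2
          rwa [Submodule.map_comap_subtype, inf_eq_right.2 h] at this
        · exact Submodule.map_subtype_le _ _⟩
      invFun := fun K => ⟨K.1.comap I.subtype, Submodule.comap_mono K.2.1⟩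
      left_inv := fun p => Subtype.ext (by
        simp [Submodule.comap_map_eq])
      right_inv := fun K => Subtype.ext (by
        simpa [Submodule.map_comap_subtype] using K.2.2)
      map_rel_iff' := by
        intro p q
        exact Submodule.map_le_map_iff_of_injective (f := I.subtype) I.injective_subtype p.1 q.1 }

theorem coe_relLength {J I : Submodule R M} (h : J ≤ I) :
    (relLength J I : WithBot ℕ∞) = Order.krullDim (Set.Icc J I) := by
  rw [relLength, Module.coe_length]
  exact Order.krullDim_eq_of_orderIso (submoduleQuotientIso h)

theorem relLength_eq_of_orderIso {J I : Submodule R M} {J' I' : Submodule R N} (h : J ≤ I)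
    (h' : J' ≤ I') (e : Set.Icc J I ≃o Set.Icc J' I') : relLength J I = relLength J' I' := by
  have := Order.krullDim_eq_of_orderIso e
  rw [← coe_relLength h, ← coe_relLength h'] at this
  exact_mod_cast this

theorem relLength_eq_of_orderIso_dual {J I : Submodule R M} {J' I' : Submodule R N} (h : J ≤ I)
    (h' : J' ≤ I') (e : Set.Icc J I ≃o (Set.Icc J' I')ᵒᵈ) : relLength J I = relLength J' I' := by
  have := Order.krullDim_eq_of_orderIso e
  rw [Order.krullDim_orderDual, ← coe_relLength h, ← coe_relLength h'] at this
  exact_mod_cast this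

theorem relLength_add {J I K : Submodule R M} (h : J ≤ I) (h' : I ≤ K) :
    relLength J I + relLength I K = relLength J K := by
  have hle : J.comap I.subtype ≤ (J.comap K.subtype).comap (Submodule.inclusion h') :=
    fun x hx => hx
  have hle' : J.comap K.subtype ≤ I.comap K.subtype := Submodule.comap_mono h
  refine (Module.length_eq_add_of_exact
    (Submodule.mapQ _ _ (Submodule.inclusion h') hle) (Submodule.factor hle') ?_
    (Submodule.factor_surjective _) ?_).symm
  · rw [← LinearMap.ker_eq_bot, LinearMap.ker_eq_bot']
    intro q hq
    obtain ⟨x, rfl⟩ := Submodule.mkQ_surjective _ q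
    rw [Submodule.mkQ_apply, Submodule.mapQ_apply, Submodule.Quotient.mk_eq_zero] at hq
    rwa [Submodule.mkQ_apply, Submodule.Quotient.mk_eq_zero]
  · intro q
    obtain ⟨x, rfl⟩ := Submodule.mkQ_surjective _ q
    constructor
    · intro hx
      rw [Submodule.factor_mk, Submodule.mkQ_apply,
        Submodule.Quotient.mk_eq_zero] at hx
      exact ⟨Submodule.Quotient.mk ⟨x.1, hx⟩, rfl⟩
    · rintro ⟨q, hq⟩
      obtain ⟨y, rfl⟩ := Submodule.mkQ_surjective _ q
      rw [← hq, Submodule.mkQ_apply, Submodule.mapQ_apply, ← Submodule.mkQ_apply,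
        Submodule.factor_mk, Submodule.mkQ_apply, Submodule.Quotient.mk_eq_zero]
      exact y.2

theorem relLength_inf {A B : Submodule R M} : relLength (A ⊓ B) A = relLength B (A ⊔ B) :=
  relLength_eq_of_orderIso inf_le_left le_sup_right (infIccOrderIsoIccSup A B)

theorem relLength_mono {J J' I I' : Submodule R M} (h₁ : J' ≤ J) (h₂ : J ≤ I) (h₃ : I ≤ I') :
    relLength J I ≤ relLength J' I' := by
  rw [← relLength_add (h₁.trans h₂) h₃, ← relLength_add h₁ h₂, add_comm (relLength J' J), add_assoc]
  exact le_self_add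

theorem relLength_eq_zero_iff {J I : Submodule R M} : relLength J I = 0 ↔ I ≤ J := by
  rw [relLength, Module.length_eq_zero_iff, Submodule.Quotient.subsingleton_iff,
    Submodule.comap_subtype_eq_top]

theorem relLength_self (I : Submodule R M) : relLength I I = 0 :=
  relLength_eq_zero_iff.2 le_rfl

theorem one_le_relLength {J I : Submodule R M} (h : ¬ I ≤ J) : 1 ≤ relLength J I :=
  Order.one_le_iff_ne_zero.2 fun h0 => h (relLength_eq_zero_iff.1 h0)

theorem relLength_map {J I : Submodule R M} (h : J ≤ I) {f : M →ₗ[R] N}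
    (hf : Function.Injective f) : relLength (J.map f) (I.map f) = relLength J I := by
  refine (relLength_eq_of_orderIso h (Submodule.map_mono h)
    { toFun := fun K => ⟨K.1.map f, Submodule.map_mono K.2.1, Submodule.map_mono K.2.2⟩
      invFun := fun K => ⟨K.1.comap f, ?_, ?_⟩
      left_inv := fun K => Subtype.ext (Submodule.comap_map_eq_of_injective hf _)
      right_inv := fun K => Subtype.ext (Submodule.map_comap_eq_of_le ?_)
      map_rel_iff' := ?_ }).symm
  · exact Submodule.map_le_iff_le_comap.1 K.2.1
  · exact (Submodule.comap_mono K.2.2).trans_eq (Submodule.comap_map_eq_of_injective hf I)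
  · exact K.2.2.trans (LinearMap.map_le_range)
  · intro K K'
    exact Submodule.map_le_map_iff_of_injective hf K.1 K'.1

theorem relLength_top (I : Submodule R M) : relLength I ⊤ = Module.length R (M ⧸ I) :=
  (Submodule.Quotient.equiv _ _ (Submodule.topEquiv : _ ≃ₗ[R] M) (by
    ext x; simp)).length_eq

end RelLength

section UnitMul

variable {R A : Type*} [CommRing R] [CommRing A] [Algebra R A]

/-- Multiplication by an invertible submodule preserves lengths. -/
theorem relLength_mul {P P' J I : Submodule R A} (hP : P * P' = 1) (h : J ≤ I) :
    relLength (P * J) (P * I) = relLength J I := by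
  have hP' : P' * P = 1 := by rw [mul_comm, hP]
  refine (relLength_eq_of_orderIso h (mul_le_mul' le_rfl h)
    { toFun := fun K => ⟨P * K.1, mul_le_mul' le_rfl K.2.1,
        mul_le_mul' le_rfl K.2.2⟩
      invFun := fun K => ⟨P' * K.1, ?_, ?_⟩
      left_inv := fun K => Subtype.ext (by simp [← mul_assoc, hP'])
      right_inv := fun K => Subtype.ext (by simp [← mul_assoc, hP])
      map_rel_iff' := ?_ }).symm
  · simpa [← mul_assoc, hP'] using mul_le_mul' (le_refl P') K.2.1
  · simpa [← mul_assoc, hP'] using mul_le_mul' (le_refl P') K.2.2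
  · intro K K'
    refine ⟨fun hK => ?_, fun hK => mul_le_mul' (le_refl P) (show K.1 ≤ K'.1 from hK)⟩
    have := mul_le_mul' (le_refl P') (show P * K.1 ≤ P * K'.1 from hK)
    simpa [← mul_assoc, hP'] using this

theorem relLength_coeSubmodule [FaithfulSMul R A] (I : Ideal R) :
    relLength (IsLocalization.coeSubmodule A I) 1 = Module.length R (R ⧸ I) := by
  rw [← relLength_top, ← relLength_map le_top (f := Algebra.linearMap R A)
    (FaithfulSMul.algebraMap_injective R A), Submodule.one_eq_range, LinearMap.range_eq_map]
  rfl

end UnitMul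

/-! ### Ideal arithmetic in almost Gorenstein rings -/

section Duality

variable {R A : Type*} [CommRing R] [CommRing A] [Algebra R A]

theorem div_le_div_left' {I J K : Submodule R A} (h : J ≤ K) : I / K ≤ I / J :=
  Submodule.le_div_iff_mul_le.2 ((mul_le_mul' le_rfl h).trans
    (Submodule.le_div_iff_mul_le.1 le_rfl))

theorem div_one' (I : Submodule R A) : I / 1 = I :=
  le_antisymm (by simpa using Submodule.le_div_iff_mul_le.1 (le_refl (I / 1)))
    (Submodule.le_div_iff_mul_le.2 (by simp))

theorem div_sup (I J K : Submodule R A) : I / (J ⊔ K) = (I / J) ⊓ (I / K) := by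
  refine le_antisymm (le_inf (div_le_div_left' le_sup_left) (div_le_div_left' le_sup_right)) ?_
  rw [Submodule.le_div_iff_mul_le, Submodule.mul_sup]
  exact sup_le (Submodule.le_div_iff_mul_le.1 inf_le_left)
    (Submodule.le_div_iff_mul_le.1 inf_le_right)

theorem div_mul_eq (I J K : Submodule R A) : I / (J * K) = I / J / K := by
  refine le_antisymm ?_ ?_
  · rw [Submodule.le_div_iff_mul_le, Submodule.le_div_iff_mul_le, mul_assoc, mul_comm K]
    exact Submodule.le_div_iff_mul_le.1 le_rfl
  · rw [Submodule.le_div_iff_mul_le, mul_comm J, ← mul_assoc, ← Submodule.le_div_iff_mul_le,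
      ← Submodule.le_div_iff_mul_le]

/-- `I ↦ ω : I` is an anti-automorphism of the lattice of reflexive submodules, so it preserves
lengths. -/
theorem relLength_div {ω J I : Submodule R A} (h : J ≤ I)
    (h₁ : ∀ K, J ≤ K → K ≤ I → ω / (ω / K) = K)
    (h₂ : ∀ K, ω / I ≤ K → K ≤ ω / J → ω / (ω / K) = K) :
    relLength (ω / I) (ω / J) = relLength J I := by
  refine (relLength_eq_of_orderIso_dual h (div_le_div_left' h)
    { toFun := fun K => OrderDual.toDual
        ⟨ω / K.1, div_le_div_left' K.2.2, div_le_div_left' K.2.1⟩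
      invFun := fun K => ⟨ω / (OrderDual.ofDual K).1, ?_, ?_⟩
      left_inv := fun K => Subtype.ext (h₁ _ K.2.1 K.2.2)
      right_inv := fun K => OrderDual.ofDual.injective
        (Subtype.ext (h₂ _ (OrderDual.ofDual K).2.1 (OrderDual.ofDual K).2.2))
      map_rel_iff' := ?_ }).symm
  · exact (h₁ J le_rfl h).symm.le.trans (div_le_div_left' (OrderDual.ofDual K).2.2)
  · exact (div_le_div_left' (OrderDual.ofDual K).2.1).trans (h₁ I h le_rfl).le
  · intro K K'
    refine ⟨fun hK => ?_, fun hK => div_le_div_left' (show K.1 ≤ K'.1 from hK)⟩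
    have := div_le_div_left' (I := ω) (show ω / K'.1 ≤ ω / K.1 from hK)
    rw [h₁ _ K.2.1 K.2.2, h₁ _ K'.2.1 K'.2.2] at this
    exact this

theorem le_mul_iff_of_mul_eq_one {X X' : Submodule R A} (hX : X * X' = 1) {I J : Submodule R A} :
    I ≤ X * J ↔ X' * I ≤ J := by
  have hX' : X' * X = 1 := by rw [mul_comm, hX]
  constructor <;> intro h
  · simpa [← mul_assoc, hX'] using mul_le_mul' (le_refl X') h
  · simpa [← mul_assoc, hX] using mul_le_mul' (le_refl X) h

theorem div_eq_mul_of_mul_eq_one {X X' : Submodule R A} (hX : X * X' = 1) (I : Submodule R A) :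
    I / X = X' * I := by
  have hX' : X' * X = 1 := by rw [mul_comm, hX]
  refine le_antisymm ?_ ?_
  · rw [le_mul_iff_of_mul_eq_one hX', mul_comm]
    exact Submodule.le_div_iff_mul_le.1 le_rfl
  · rw [Submodule.le_div_iff_mul_le, mul_comm, ← mul_assoc, hX, one_mul]

/-- If `ω : ω = R`, then `ω : T` is the conductor `R : T` of a ring `T` that contains `ω`. -/
theorem div_eq_one_div {ω T : Submodule R A} (hω : ω / ω = 1) (h1 : 1 ≤ ω) (h : ω ≤ T)
    (hT : T * T = T) : ω / T = 1 / T := by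
  refine le_antisymm ?_ ?_
  · rw [← hω, Submodule.le_div_iff_mul_le, Submodule.le_div_iff_mul_le, mul_assoc]
    refine (mul_le_mul' le_rfl ((mul_le_mul' le_rfl h).trans hT.le)).trans ?_
    exact Submodule.le_div_iff_mul_le.1 le_rfl
  · rw [Submodule.le_div_iff_mul_le]
    exact (Submodule.le_div_iff_mul_le.1 le_rfl).trans h1

end Duality

/-- The ideal arithmetic behind the almost Gorenstein property, for submodules of a ring `A` over
`R`: `T` plays the role of the normalization, `c` of the conductor, `ω` of the canonical ideal,
`𝔪` of the maximal ideal, and `X` (with inverse `X'`) of a principal reduction of `𝔪`. -/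
structure AlmostGorensteinFrame {R A : Type*} [CommRing R] [CommRing A] [Algebra R A]
    (T c ω 𝔪 X X' : Submodule R A) : Prop where
  one_le : 1 ≤ ω
  le : ω ≤ T
  mul_self : T * T = T
  conductor : c = 1 / T
  dual : ∀ K, c ≤ K → K ≤ T → ω / (ω / K) = K
  mul_omega : 𝔪 * ω ≤ 𝔪
  mul_inv : X * X' = 1
  X_le : X ≤ 𝔪
  mul_T : 𝔪 * T = X * T
  le_one : 𝔪 ≤ 1
  le_of_lt : ∀ K ≤ 1, ¬ 1 ≤ K → K ≤ 𝔪
  not_one_le : ¬ 1 ≤ X * T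
  finite : relLength c T ≠ ⊤

namespace AlmostGorensteinFrame

variable {R A : Type*} [CommRing R] [CommRing A] [Algebra R A]
  {T c ω 𝔪 X X' : Submodule R A}

theorem one_le_T (F : AlmostGorensteinFrame T c ω 𝔪 X X') : 1 ≤ T := F.one_le.trans F.le

theorem c_le_one (F : AlmostGorensteinFrame T c ω 𝔪 X X') : c ≤ 1 := by
  have := div_le_div_left' (I := 1) F.one_le_T
  rwa [div_one', ← F.conductor] at this

theorem c_mul_T (F : AlmostGorensteinFrame T c ω 𝔪 X X') : c * T = c := by
  refine le_antisymm ?_ ?_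
  · conv_rhs => rw [F.conductor]
    rw [Submodule.le_div_iff_mul_le, mul_assoc, F.mul_self, ← Submodule.le_div_iff_mul_le,
      F.conductor]
  · simpa using mul_le_mul' (le_refl c) F.one_le_T

theorem le_mul_T (F : AlmostGorensteinFrame T c ω 𝔪 X X') (I : Submodule R A) : I ≤ I * T := by
  simpa using mul_le_mul' (le_refl I) F.one_le_T

theorem not_one_le_m (F : AlmostGorensteinFrame T c ω 𝔪 X X') : ¬ 1 ≤ 𝔪 := fun h =>
  F.not_one_le (h.trans ((F.le_mul_T _).trans F.mul_T.le))

theorem omega_div_omega (F : AlmostGorensteinFrame T c ω 𝔪 X X') : ω / ω = 1 := by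
  have := F.dual 1 F.c_le_one F.one_le_T
  rwa [div_one'] at this

theorem omega_div_T (F : AlmostGorensteinFrame T c ω 𝔪 X X') : ω / T = c := by
  rw [F.conductor, div_eq_one_div F.omega_div_omega F.one_le F.le F.mul_self]

theorem relLength_dual (F : AlmostGorensteinFrame T c ω 𝔪 X X') {J I : Submodule R A}
    (h₁ : c ≤ J) (h : J ≤ I) (h₂ : I ≤ T) : relLength (ω / I) (ω / J) = relLength J I := by
  have hc : c ≤ T := F.c_le_one.trans F.one_le_T
  refine relLength_div h (fun K hK hK' => F.dual K (h₁.trans hK) (hK'.trans h₂))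
    (fun K hK hK' => F.dual K ?_ ?_)
  · rw [← F.omega_div_T]; exact (div_le_div_left' h₂).trans hK
  · rw [← F.dual T hc le_rfl, F.omega_div_T]
    exact hK'.trans (div_le_div_left' h₁)

/-- `ℓ(T / ω) = ℓ(R / c)`. -/
theorem relLength_omega_T (F : AlmostGorensteinFrame T c ω 𝔪 X X') :
    relLength ω T = relLength c 1 := by
  rw [← F.relLength_dual (F.c_le_one.trans F.one_le) F.le le_rfl, F.omega_div_T,
    F.omega_div_omega]

theorem relLength_c_T (F : AlmostGorensteinFrame T c ω 𝔪 X X') :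
    relLength c T = relLength c 1 + relLength 1 ω + relLength c 1 := by
  conv_rhs => rw [← F.relLength_omega_T]
  rw [F.relLength_omega_T, relLength_add F.c_le_one F.one_le, ← F.relLength_omega_T,
    relLength_add (F.c_le_one.trans F.one_le) F.le]

theorem c_le_m (F : AlmostGorensteinFrame T c ω 𝔪 X X') (h : ¬ 1 ≤ c) : c ≤ 𝔪 :=
  F.le_of_lt c F.c_le_one h

theorem m_le_mul_T (F : AlmostGorensteinFrame T c ω 𝔪 X X') : 𝔪 ≤ X * T :=
  (F.le_mul_T _).trans F.mul_T.le

theorem not_X_le_c (F : AlmostGorensteinFrame T c ω 𝔪 X X') (h : ¬ 1 ≤ c) (hc : c ≠ 𝔪) :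
    ¬ X ≤ c := fun hX =>
  hc (le_antisymm (F.c_le_m h)
    (F.m_le_mul_T.trans ((mul_le_mul' hX le_rfl).trans F.c_mul_T.le)))

theorem relLength_c_one (F : AlmostGorensteinFrame T c ω 𝔪 X X') (h : ¬ 1 ≤ c) :
    relLength c (X ⊔ c) + relLength (X ⊔ c) 𝔪 + relLength 𝔪 1 = relLength c 1 := by
  rw [relLength_add le_sup_right (sup_le F.X_le (F.c_le_m h)), relLength_add (F.c_le_m h) F.le_one]

theorem mul_omega_le (F : AlmostGorensteinFrame T c ω 𝔪 X X') : X * ω ≤ 𝔪 :=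
  (mul_le_mul' F.X_le le_rfl).trans F.mul_omega

theorem omega_div_mul_T (F : AlmostGorensteinFrame T c ω 𝔪 X X') : ω / (X * T) = X' * c := by
  rw [mul_comm, div_mul_eq, F.omega_div_T, div_eq_mul_of_mul_eq_one F.mul_inv]

/-- Multiplication by a principal reduction `x` of `𝔪` embeds `ω / (R + U)`, where
`U = {w ∈ ω | x w ∈ c}`, into `𝔪 / (x R + c)`; the latter misses at least `(x R + c) / c` and
`R / 𝔪` from `R / c`. -/
theorem relLength_sup_add_two_le (F : AlmostGorensteinFrame T c ω 𝔪 X X') (h : ¬ 1 ≤ c)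
    (hc : c ≠ 𝔪) :
    relLength (1 ⊔ ω ⊓ X' * c) ω + 2 ≤ relLength c 1 := by
  have hinv : X' * X = 1 := by rw [mul_comm, F.mul_inv]
  have hle : 1 ⊔ ω ⊓ X' * c ≤ ω := sup_le F.one_le inf_le_left
  have hX : X ≤ X * ω := by simpa using mul_le_mul' (le_refl X) F.one_le
  have hmod : X * ω ⊓ (X ⊔ c) ≤ X * (1 ⊔ ω ⊓ X' * c) := by
    rw [inf_comm, sup_inf_assoc_of_le _ hX, Submodule.mul_sup, mul_one]
    refine sup_le_sup le_rfl ?_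
    rw [le_mul_iff_of_mul_eq_one F.mul_inv]
    refine le_inf ?_ (mul_le_mul' le_rfl inf_le_left)
    rw [← le_mul_iff_of_mul_eq_one F.mul_inv]
    exact inf_le_right
  have h1 : relLength (1 ⊔ ω ⊓ X' * c) ω ≤ relLength (X ⊔ c) 𝔪 := by
    rw [← relLength_mul F.mul_inv hle]
    refine (relLength_mono hmod (mul_le_mul' le_rfl hle) le_rfl).trans ?_
    rw [relLength_inf]
    exact relLength_mono le_rfl le_sup_right
      (sup_le F.mul_omega_le (sup_le F.X_le (F.c_le_m h)))
  have h2 : 1 ≤ relLength c (X ⊔ c) :=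
    one_le_relLength fun hX => F.not_X_le_c h hc (le_sup_left.trans hX)
  have h3 : 1 ≤ relLength 𝔪 1 := one_le_relLength F.not_one_le_m
  calc relLength (1 ⊔ ω ⊓ X' * c) ω + 2 ≤ relLength (X ⊔ c) 𝔪 + (1 + 1) := by
        rw [one_add_one_eq_two]; gcongr
    _ ≤ relLength (X ⊔ c) 𝔪 + (relLength c (X ⊔ c) + relLength 𝔪 1) := by gcongr
    _ = relLength c 1 := by rw [← F.relLength_c_one h]; abel

/-- With `U = {w ∈ ω | x w ∈ c} = ω : (R + x T)`, the module `(R + U) / R` is dual to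
`ω / (ω ∩ (R + x T))`, a proper quotient of `ω / (ω ∩ x T)`; the length of the latter is at most
that of `𝔪 / 𝔪 ^ 2`, as `𝔪 ^ 2 ⊆ x ^ 2 T`. -/
theorem relLength_one_sup_add_one_le (F : AlmostGorensteinFrame T c ω 𝔪 X X') :
    relLength 1 (1 ⊔ ω ⊓ X' * c) + 1 ≤ relLength (𝔪 * 𝔪) 𝔪 := by
  have hXT : X * T ≤ T := by
    simpa using mul_le_mul' (F.X_le.trans F.le_one) (le_refl T)
  have hD : ω / (1 ⊔ X * T) = ω ⊓ X' * c := by rw [div_sup, div_one', F.omega_div_mul_T]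
  have hdual : ω / (ω ⊓ X' * c) = 1 ⊔ X * T := by
    rw [← hD, F.dual _ (F.c_le_one.trans le_sup_left) (sup_le F.one_le_T hXT)]
  have h1 : relLength 1 (1 ⊔ ω ⊓ X' * c) = relLength (ω ⊓ (1 ⊔ X * T)) ω := by
    rw [← F.relLength_dual F.c_le_one le_sup_left
      (sup_le F.one_le_T (inf_le_left.trans F.le)), div_sup, div_one', hdual]
  have h2 : 1 ≤ relLength (ω ⊓ X * T) (ω ⊓ (1 ⊔ X * T)) :=
    one_le_relLength fun hle => F.not_one_le
      ((le_inf F.one_le le_sup_left).trans (hle.trans inf_le_right))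
  have hsub : X * ω ⊓ 𝔪 * 𝔪 ≤ X * (ω ⊓ X * T) := by
    rw [le_mul_iff_of_mul_eq_one F.mul_inv]
    refine le_inf ?_ ?_ <;> rw [← le_mul_iff_of_mul_eq_one F.mul_inv]
    · exact inf_le_left
    · refine inf_le_right.trans ((mul_le_mul' F.m_le_mul_T F.m_le_mul_T).trans ?_)
      rw [mul_mul_mul_comm, F.mul_self, mul_assoc]
  have h3 : relLength (ω ⊓ X * T) ω ≤ relLength (𝔪 * 𝔪) 𝔪 := by
    rw [← relLength_mul F.mul_inv (inf_le_left : ω ⊓ X * T ≤ ω)]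
    refine (relLength_mono hsub (mul_le_mul' le_rfl inf_le_left) le_rfl).trans ?_
    rw [relLength_inf]
    refine relLength_mono le_rfl le_sup_right (sup_le F.mul_omega_le ?_)
    simpa using mul_le_mul' F.le_one (le_refl 𝔪)
  rw [h1, add_comm]
  refine le_trans ?_ h3
  rw [← relLength_add (inf_le_inf le_rfl le_sup_right : ω ⊓ X * T ≤ ω ⊓ (1 ⊔ X * T)) inf_le_left]
  gcongr

theorem relLength_one_omega_add_three_le (F : AlmostGorensteinFrame T c ω 𝔪 X X') (h : ¬ 1 ≤ c)
    (hc : c ≠ 𝔪) :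
    relLength 1 ω + 3 ≤ relLength c 1 + relLength (𝔪 * 𝔪) 𝔪 := by
  have h1 := F.relLength_sup_add_two_le h hc
  have h2 := F.relLength_one_sup_add_one_le
  calc relLength 1 ω + 3
      = (relLength (1 ⊔ ω ⊓ X' * c) ω + 2) + (relLength 1 (1 ⊔ ω ⊓ X' * c) + 1) := by
        rw [← relLength_add (le_sup_left : 1 ≤ 1 ⊔ ω ⊓ X' * c) (sup_le F.one_le inf_le_left),
          show (3 : ℕ∞) = 2 + 1 from rfl]
        abel
    _ ≤ _ := add_le_add h1 h2

/-- If the conductor is the maximal ideal, then `ℓ(T / c)` is the embedding dimension. -/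
theorem relLength_m_T (F : AlmostGorensteinFrame T c ω 𝔪 X X') (hc : c = 𝔪) :
    relLength c T = relLength (𝔪 * 𝔪) 𝔪 := by
  have hm : 𝔪 = X * T := by rw [← F.mul_T, ← hc, F.c_mul_T]
  have hmm : 𝔪 * 𝔪 = X * 𝔪 := by
    conv_lhs => rw [hm, mul_mul_mul_comm, F.mul_self, mul_assoc, ← hm]
  rw [hmm, hc]
  conv_rhs => enter [2]; rw [hm]
  rw [relLength_mul F.mul_inv (F.le_one.trans F.one_le_T)]

/-- If `𝔪` is principal, then `R` is already normal: otherwise `X' * c` would be a module over the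
normalization inside `R`, hence contained in `c`. -/
theorem m_ne_X (F : AlmostGorensteinFrame T c ω 𝔪 X X') (h : ¬ 1 ≤ c) {Y Y' : Submodule R A}
    (hY : Y * Y' = 1) (hc : c = Y * T) : 𝔪 ≠ X := fun hm => by
  have h1 : X' * c ≤ 1 := by
    rw [← le_mul_iff_of_mul_eq_one F.mul_inv, mul_one, ← hm]
    exact F.c_le_m h
  have h2 : X' * c ≤ c := by
    conv_rhs => rw [F.conductor]
    rwa [Submodule.le_div_iff_mul_le, mul_assoc, F.c_mul_T]
  rw [← le_mul_iff_of_mul_eq_one F.mul_inv, hc, mul_left_comm, le_mul_iff_of_mul_eq_one hY,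
    ← mul_assoc, mul_comm Y', hY, one_mul] at h2
  exact F.not_one_le (F.one_le_T.trans h2)

end AlmostGorensteinFrame

/-! ### Embedding dimension at most two -/

/-- If the maximal ideal is generated by `x` and `z`, then `R / x` is uniserial, so its socle is
generated by a single element. -/
theorem exists_socle_generator {R : Type*} [CommRing R] [IsLocalRing R] {x z : R}
    (hm : maximalIdeal R = Ideal.span {x, z}) (hz : ∃ k, z ^ k ∈ Ideal.span {x}) :
    ∃ g : R, (∀ y ∈ maximalIdeal R, y * g ∈ Ideal.span {x}) ∧
      ∀ s : R, (∀ y ∈ maximalIdeal R, y * s ∈ Ideal.span {x}) → ∃ a b, s = a * g + b * x := by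
  classical
  have hx : x ∈ maximalIdeal R := hm ▸ Ideal.subset_span (by simp)
  have hzm : z ∈ maximalIdeal R := hm ▸ Ideal.subset_span (by simp)
  have hmem : ∀ y ∈ maximalIdeal R, ∃ a b, y = a * x + b * z := fun y hy => by
    rw [hm, Ideal.mem_span_pair] at hy
    obtain ⟨a, b, h⟩ := hy
    exact ⟨a, b, h.symm⟩
  obtain ⟨N, hN⟩ : ∃ N, Nat.find hz = N + 1 := Nat.exists_eq_succ_of_ne_zero fun h0 => by
    have := Nat.find_spec hz
    rw [h0, pow_zero] at this
    exact (mem_maximalIdeal x).1 hx (Ideal.span_singleton_eq_top.1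
      ((Ideal.eq_top_iff_one _).2 this))
  have hN1 : z ^ (N + 1) ∈ Ideal.span {x} := hN ▸ Nat.find_spec hz
  refine ⟨z ^ N, fun y hy => ?_, fun s hs => ?_⟩
  · obtain ⟨a, b, rfl⟩ := hmem y hy
    have : (a * x + b * z) * z ^ N = a * z ^ N * x + b * z ^ (N + 1) := by ring
    rw [this]
    exact add_mem (Ideal.mul_mem_left _ _ (Ideal.mem_span_singleton_self x))
      (Ideal.mul_mem_left _ _ hN1)
  · suffices H : ∀ j ≤ N, ∃ a b, s = a * z ^ j + b * x from H N le_rfl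
    intro j
    induction j with
    | zero => exact fun _ => ⟨s, 0, by ring⟩
    | succ j ih =>
      intro hj
      obtain ⟨a, b, hab⟩ := ih (by omega)
      by_cases ha : IsUnit a
      · exfalso
        obtain ⟨u, rfl⟩ := ha
        refine Nat.find_min hz (m := j + 1) (by omega) ?_
        have : z ^ (j + 1) = ↑u⁻¹ * (z * s) - ↑u⁻¹ * z * b * x := by
          rw [hab]
          linear_combination (-(z ^ (j + 1))) * u.inv_mul
        rw [this]
        exact sub_mem (Ideal.mul_mem_left _ _ (hs z hzm))
          (Ideal.mul_mem_left _ _ (Ideal.mem_span_singleton_self x))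
      · obtain ⟨c, d, rfl⟩ := hmem a ((mem_maximalIdeal a).2 ha)
        exact ⟨d, c * z ^ j + b, by rw [hab]; ring⟩

/-- An almost Gorenstein ring of embedding dimension at most two is Gorenstein: otherwise
`ω = R : 𝔪` would be a ring, contradicting `ω : ω = R`. -/
theorem AlmostGorensteinFrame.omega_eq_one {R A : Type*} [CommRing R] [IsLocalRing R] [CommRing A]
    [Algebra R A] [FaithfulSMul R A] {T c ω X' : Submodule R A} {x z : R}
    (F : AlmostGorensteinFrame T c ω (IsLocalization.coeSubmodule A (maximalIdeal R))
      (Submodule.span R {algebraMap R A x}) X')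
    (hm : maximalIdeal R = Ideal.span {x, z}) (hz : ∃ k, z ^ k ∈ Ideal.span {x}) : ω = 1 := by
  obtain ⟨g, hg, hsoc⟩ := exists_socle_generator hm hz
  set X := Submodule.span R {algebraMap R A x}
  set 𝔪 := IsLocalization.coeSubmodule A (maximalIdeal R)
  have hinj := FaithfulSMul.algebraMap_injective R A
  -- `x` is a non-zero-divisor in `A`
  have hcancel : ∀ {a b : A}, algebraMap R A x * a = algebraMap R A x * b → a = b := by
    intro a b hab
    have hmem : a - b ∈ X' * (X * Submodule.span R {a - b}) := by
      rw [← mul_assoc, mul_comm X', F.mul_inv, one_mul]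
      exact Submodule.mem_span_singleton_self _
    rw [Submodule.span_mul_span, Set.singleton_mul_singleton, mul_sub, hab, sub_self,
      Submodule.span_zero_singleton, Submodule.mul_bot, Submodule.mem_bot, sub_eq_zero] at hmem
    exact hmem
  have hX : ∀ r : R, algebraMap R A r ∈ X ↔ r ∈ Ideal.span {x} := fun r => by
    rw [Submodule.mem_span_singleton, Ideal.mem_span_singleton']
    refine exists_congr fun a => ?_
    rw [Algebra.smul_def, ← map_mul]
    exact hinj.eq_iff
  -- elements of `R : 𝔪` are of the form `(a g + b x) / x`
  have hdiv : ∀ q ∈ 1 / 𝔪, ∃ a b : R, algebraMap R A x * q = algebraMap R A (a * g + b * x) := by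
    intro q hq
    obtain ⟨s, hs⟩ := Submodule.mem_one.1
      (Submodule.mem_div_iff_forall_mul_mem.1 hq _ (F.X_le (Submodule.mem_span_singleton_self _)))
    obtain ⟨a, b, hab⟩ := hsoc s fun y hy => by
      obtain ⟨t, ht⟩ := Submodule.mem_one.1 (Submodule.mem_div_iff_forall_mul_mem.1 hq
        (algebraMap R A y) ((IsLocalization.mem_coeSubmodule A _).2 ⟨y, hy, rfl⟩))
      refine Ideal.mem_span_singleton'.2 ⟨t, hinj ?_⟩
      rw [map_mul, map_mul, hs, ht]
      ring
    exact ⟨a, b, by rw [← hab, hs, mul_comm]⟩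
  have hω : ω ≤ 1 / 𝔪 := Submodule.le_div_iff_mul_le.2 ((mul_comm ω 𝔪).le.trans
    (F.mul_omega.trans F.le_one))
  by_contra hne
  have hnle : ¬ ω ≤ 1 := fun h => hne (le_antisymm h F.one_le)
  obtain ⟨w, hw, hw1⟩ := SetLike.not_le_iff_exists.1 hnle
  obtain ⟨a, b, hab⟩ := hdiv w (hω hw)
  have hle : 1 / 𝔪 ≤ ω := by
    have ha : IsUnit a := by
      by_contra ha
      obtain ⟨d, hd⟩ := Ideal.mem_span_singleton'.1 (hg a ((mem_maximalIdeal a).2 ha))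
      refine hw1 (Submodule.mem_one.2 ⟨d + b, hcancel ?_⟩)
      rw [hab, ← hd, ← map_mul]
      congr 1; ring
    obtain ⟨u, rfl⟩ := ha
    intro q hq
    obtain ⟨a', b', hab'⟩ := hdiv q hq
    have : q = (a' * ↑u⁻¹) • w + (b' - a' * ↑u⁻¹ * b) • 1 := by
      apply hcancel
      have hu : algebraMap R A ↑u⁻¹ * algebraMap R A ↑u = 1 := by
        rw [← map_mul, u.inv_mul, map_one]
      simp only [Algebra.smul_def, map_mul, map_sub, map_add] at hab hab' ⊢
      linear_combination hab' - algebraMap R A a' * algebraMap R A ↑u⁻¹ * hab -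
        algebraMap R A a' * algebraMap R A g * hu
    rw [this]
    exact add_mem (ω.smul_mem _ hw) (ω.smul_mem _ (Submodule.one_le.1 F.one_le))
  apply hnle
  have hsq : ω * ω ≤ ω := by
    refine le_trans ?_ hle
    rw [Submodule.le_div_iff_mul_le, mul_comm, ← mul_assoc]
    exact (mul_le_mul' F.mul_omega le_rfl).trans (F.mul_omega.trans F.le_one)
  rw [← F.omega_div_omega]
  exact Submodule.le_div_iff_mul_le.2 hsq

/-! ### Regular fractional ideals -/

section RegularFractional

theorem span_singleton_mul_inv {R A : Type*} [CommRing R] [CommRing A] [Algebra R A] (u : Aˣ) :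
    Submodule.span R {(u : A)} * Submodule.span R {((u⁻¹ : Aˣ) : A)} = 1 := by
  rw [Submodule.span_mul_span, Set.singleton_mul_singleton, u.mul_inv, Submodule.one_eq_span]

variable {R : Type*} [CommRing R]

theorem exists_unit_eq_algebraMap {a : R} (ha : a ∈ R⁰) :
    ∃ u : (FractionRing R)ˣ, (u : FractionRing R) = algebraMap R (FractionRing R) a :=
  IsLocalization.map_units (FractionRing R) (⟨a, ha⟩ : R⁰)

theorem isUnit_of_mem_nonZeroDivisors {q : FractionRing R} (hq : q ∈ (FractionRing R)⁰) :
    IsUnit q := by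
  obtain ⟨⟨a, s⟩, h⟩ := IsLocalization.surj R⁰ q
  have ha : a ∈ R⁰ := by
    rw [mem_nonZeroDivisors_iff_right]
    intro r hr
    have h0 : algebraMap R (FractionRing R) r * algebraMap R (FractionRing R) s = 0 := by
      refine (mem_nonZeroDivisors_iff_right.1 hq) _ ?_
      rw [mul_assoc, mul_comm _ q, h, ← map_mul, hr, map_zero]
    rw [← map_mul, FaithfulSMul.algebraMap_eq_zero_iff] at h0
    exact (mem_nonZeroDivisors_iff_right.1 s.2) _ h0
  refine isUnit_of_mul_isUnit_left (y := algebraMap R (FractionRing R) s) ?_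
  rw [h]
  exact IsLocalization.map_units (FractionRing R) (⟨a, ha⟩ : R⁰)

theorem isFractional_iff_mul_le_one {J : Submodule R (FractionRing R)} :
    IsFractional R⁰ J ↔
      ∃ a ∈ R⁰, Submodule.span R {algebraMap R (FractionRing R) a} * J ≤ 1 := by
  refine exists_congr fun a => and_congr Iff.rfl ?_
  rw [Submodule.mul_le]
  simp only [Submodule.mem_one, IsLocalization.IsInteger, Algebra.smul_def, RingHom.mem_rangeS]
  refine ⟨fun h p hp q hq => ?_, fun h q hq => h _ (Submodule.mem_span_singleton_self _) q hq⟩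
  obtain ⟨r, rfl⟩ := Submodule.mem_span_singleton.1 hp
  obtain ⟨y, hy⟩ := h q hq
  exact ⟨r * y, by rw [map_mul, hy, Algebra.smul_def]; ring⟩

theorem isRegularFractionalIdeal_iff {J : Submodule R (FractionRing R)} :
    IsRegularFractionalIdeal J ↔
      (∃ a ∈ R⁰, Submodule.span R {algebraMap R (FractionRing R) a} * J ≤ 1) ∧
      ∃ b ∈ R⁰, Submodule.span R {algebraMap R (FractionRing R) b} ≤ J := by
  rw [IsRegularFractionalIdeal, isFractional_iff_mul_le_one]
  refine and_congr Iff.rfl ⟨?_, ?_⟩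
  · rintro ⟨q, hq, hq0⟩
    obtain ⟨⟨b, s⟩, h⟩ := IsLocalization.surj R⁰ q
    refine ⟨b, ?_, ?_⟩
    · rw [mem_nonZeroDivisors_iff_right]
      intro r hr
      have := (isUnit_of_mem_nonZeroDivisors hq0).mul
        (IsLocalization.map_units (FractionRing R) s)
      rw [h] at this
      have h0 : algebraMap R (FractionRing R) r * algebraMap R (FractionRing R) b = 0 := by
        rw [← map_mul, hr, map_zero]
      rwa [this.mul_left_eq_zero, FaithfulSMul.algebraMap_eq_zero_iff] at h0
    · rw [Submodule.span_singleton_le_iff_mem]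
      have h' : q * algebraMap R (FractionRing R) s = algebraMap R (FractionRing R) b := h
      rw [← h', mul_comm, ← Algebra.smul_def]
      exact J.smul_mem _ hq
  · rintro ⟨b, hb, hbJ⟩
    exact ⟨_, hbJ (Submodule.mem_span_singleton_self _),
      (IsLocalization.map_units (FractionRing R) (⟨b, hb⟩ : R⁰)).mem_nonZeroDivisors⟩

theorem isRegularFractionalIdeal_one :
    IsRegularFractionalIdeal (1 : Submodule R (FractionRing R)) :=
  isRegularFractionalIdeal_iff.2 ⟨⟨1, one_mem _, by simp [← Submodule.one_eq_span]⟩,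
    1, one_mem _, by simp [← Submodule.one_eq_span]⟩

namespace IsRegularFractionalIdeal

variable {I J K : Submodule R (FractionRing R)}

theorem of_le_of_le (hJ : IsRegularFractionalIdeal J) (hI : IsRegularFractionalIdeal I)
    (h : J ≤ K) (h' : K ≤ I) : IsRegularFractionalIdeal K := by
  rw [isRegularFractionalIdeal_iff] at *
  obtain ⟨-, b, hb, hbJ⟩ := hJ
  obtain ⟨⟨a, ha, haI⟩, -⟩ := hI
  exact ⟨⟨a, ha, (mul_le_mul' le_rfl h').trans haI⟩, b, hb, hbJ.trans h⟩

theorem mul (hI : IsRegularFractionalIdeal I) (hJ : IsRegularFractionalIdeal J) :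
    IsRegularFractionalIdeal (I * J) :=
  ⟨hI.1.mul hJ.1, by
    obtain ⟨q, hq, hq0⟩ := hI.2
    obtain ⟨r, hr, hr0⟩ := hJ.2
    exact ⟨q * r, Submodule.mul_mem_mul hq hr, mul_mem hq0 hr0⟩⟩

theorem div (hI : IsRegularFractionalIdeal I) (hJ : IsRegularFractionalIdeal J) :
    IsRegularFractionalIdeal (I / J) := by
  rw [isRegularFractionalIdeal_iff] at *
  obtain ⟨⟨a, ha, haI⟩, b, hb, hbI⟩ := hI
  obtain ⟨⟨a', ha', haJ⟩, b', hb', hbJ⟩ := hJ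
  refine ⟨⟨a * b', mul_mem ha hb', ?_⟩, a' * b, mul_mem ha' hb, ?_⟩
  · rw [map_mul, ← Set.singleton_mul_singleton, ← Submodule.span_mul_span, mul_assoc]
    refine (mul_le_mul' le_rfl ?_).trans haI
    rw [mul_comm]
    exact (mul_le_mul' le_rfl hbJ).trans (Submodule.le_div_iff_mul_le.1 le_rfl)
  · rw [map_mul, ← Set.singleton_mul_singleton, ← Submodule.span_mul_span,
      Submodule.le_div_iff_mul_le, mul_right_comm]
    simpa using mul_le_mul' haJ hbI

theorem exists_isUnit_mem (hJ : IsRegularFractionalIdeal J) : ∃ q ∈ J, IsUnit q := by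
  obtain ⟨q, hq, hq0⟩ := hJ.2
  exact ⟨q, hq, isUnit_of_mem_nonZeroDivisors hq0⟩

theorem fg [IsNoetherianRing R] (hJ : IsRegularFractionalIdeal J) : J.FG := by
  obtain ⟨a, ha, haJ⟩ := isFractional_iff_mul_le_one.1 hJ.1
  obtain ⟨u, hu⟩ := exists_unit_eq_algebraMap ha
  rw [← hu] at haJ
  have h1 : ∀ K : Submodule R (FractionRing R), K ≤ 1 → K.FG := fun K hK => by
    rw [Submodule.one_eq_range] at hK
    rw [← Submodule.map_comap_eq_of_le hK]
    exact (IsNoetherian.noetherian _).map _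
  have : J = Submodule.span R {((u⁻¹ : (FractionRing R)ˣ) : FractionRing R)} *
      (Submodule.span R {(u : FractionRing R)} * J) := by
    rw [← mul_assoc, mul_comm (Submodule.span R _), span_singleton_mul_inv, one_mul]
  rw [this]
  exact (Submodule.fg_span_singleton _).mul (h1 _ haJ)

/-- A quotient of regular fractional ideals has finite length, if the quotients of `R` by
non-zero-divisors do. -/
theorem relLength_ne_top (hfin : ∀ a ∈ R⁰, Module.length R (R ⧸ Ideal.span {a}) ≠ ⊤)
    (hJ : IsRegularFractionalIdeal J) (hI : IsRegularFractionalIdeal I) (h : J ≤ I) :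
    relLength J I ≠ ⊤ := by
  obtain ⟨-, b, hb, hbJ⟩ := isRegularFractionalIdeal_iff.1 hJ
  obtain ⟨⟨a, ha, haI⟩, -⟩ := isRegularFractionalIdeal_iff.1 hI
  obtain ⟨u, hu⟩ := exists_unit_eq_algebraMap ha
  have h1 := relLength_mul (span_singleton_mul_inv (R := R) u) h
  rw [← h1, hu]
  refine ne_top_of_le_ne_top (hfin (a * b) (mul_mem ha hb)) ?_
  rw [← relLength_coeSubmodule (A := FractionRing R)]
  refine relLength_mono ?_ (mul_le_mul' le_rfl h) haI
  rw [IsLocalization.coeSubmodule_span_singleton, map_mul, ← Set.singleton_mul_singleton,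
    ← Submodule.span_mul_span]
  exact mul_le_mul' le_rfl hbJ

end IsRegularFractionalIdeal

end RegularFractional

/-! ### One-dimensional Cohen–Macaulay local rings -/

section DimensionOne

theorem exists_mem_maximalIdeal_nonZeroDivisors {R : Type*} [CommRing R]
    [IsLocalRing R] (hdim : ringKrullDim R = 1)
    (hCM : IsCohenMacaulayLocal R) : ∃ x ∈ maximalIdeal R, x ∈ R⁰ := by
  obtain ⟨rs, hrs, hreg, hlen⟩ := hCM
  rw [hdim] at hlen
  obtain ⟨x, rfl⟩ : ∃ x, rs = [x] := List.length_eq_one_iff.1 (by exact_mod_cast hlen.symm)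
  refine ⟨x, hrs x (by simp), ?_⟩
  have := ((RingTheory.Sequence.isRegular_cons_iff _ _ _).1 hreg).1
  rw [mem_nonZeroDivisors_iff_left]
  intro y hy
  exact this (by simpa using hy)

variable {R : Type*} [CommRing R] [IsNoetherianRing R]

theorem isArtinianRing_quotient_span (hdim : ringKrullDim R = 1) {a : R} (ha : a ∈ R⁰) :
    IsArtinianRing (R ⧸ Ideal.span {a}) := by
  rw [isArtinianRing_iff_krullDimLE_zero, Ring.krullDimLE_iff]
  have := ringKrullDim_quotient_succ_le_of_nonZeroDivisor ha
  rw [hdim] at this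
  replace this := this.trans_eq (zero_add 1).symm
  exact (WithBot.add_le_add_iff_right' WithBot.one_ne_bot
    (fun h => ENat.one_ne_top (WithBot.coe_injective h))).1 this

theorem length_quotient_span_ne_top (hdim : ringKrullDim R = 1) {a : R} (ha : a ∈ R⁰) :
    Module.length R (R ⧸ Ideal.span {a}) ≠ ⊤ := by
  have := isArtinianRing_quotient_span hdim ha
  rw [Module.length_eq_of_surjective (S := R) (R := R ⧸ Ideal.span {a})
    Ideal.Quotient.mk_surjective]
  exact Module.length_ne_top

theorem exists_pow_mem_span [IsLocalRing R] (hdim : ringKrullDim R = 1) {a x : R} (ha : a ∈ R⁰)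
    (hx : x ∈ maximalIdeal R) : ∃ n, x ^ n ∈ Ideal.span {a} := by
  have := isArtinianRing_quotient_span hdim ha
  have hnil : IsNilpotent (Ideal.Quotient.mk (Ideal.span {a}) x) := by
    rw [nilpotent_iff_mem_prime]
    intro p hp
    have := IsArtinianRing.isMaximal_of_isPrime p
    have hmax := Ideal.comap_isMaximal_of_surjective (Ideal.Quotient.mk (Ideal.span {a}))
      Ideal.Quotient.mk_surjective (K := p)
    rw [← Ideal.mem_comap, IsLocalRing.eq_maximalIdeal hmax]
    exact hx
  obtain ⟨n, hn⟩ := hnil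
  exact ⟨n, by rwa [← map_pow, Ideal.Quotient.eq_zero_iff_mem] at hn⟩

end DimensionOne

/-! ### Power series expansions in complete rings -/

section Complete

variable {S : Type*} [CommRing S]

theorem exists_adic_sum (I : Ideal S) [IsAdicComplete I S] {x : S} (hx : x ∈ I) (s : ℕ → S) :
    ∃ L : S, ∀ n, ∃ t, L = ∑ i ∈ Finset.range n, x ^ i * s i + x ^ n * t := by
  have hlim : ∀ s : ℕ → S, ∃ L : S, ∀ n, L - ∑ i ∈ Finset.range n, x ^ i * s i ∈ I ^ n := by
    intro s
    obtain ⟨L, hL⟩ := IsPrecomplete.prec' (I := I) (M := S)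
      (fun n => ∑ i ∈ Finset.range n, x ^ i * s i) (fun {m n} hmn => by
        rw [SModEq.sub_mem, smul_eq_mul, Ideal.mul_top, ← Finset.sum_range_add_sum_Ico _ hmn,
          sub_add_cancel_left]
        refine neg_mem (sum_mem fun i hi => Ideal.mul_mem_right _ _ ?_)
        exact Ideal.pow_le_pow_right (Finset.mem_Ico.1 hi).1 (Ideal.pow_mem_pow hx i))
    refine ⟨L, fun n => ?_⟩
    have := hL n
    rw [SModEq.sub_mem, smul_eq_mul, Ideal.mul_top] at this
    rw [← neg_sub]
    exact neg_mem this
  obtain ⟨L, hL⟩ := hlim s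
  refine ⟨L, fun n => ?_⟩
  obtain ⟨t, ht⟩ := hlim fun i => s (n + i)
  refine ⟨t, ?_⟩
  rw [← sub_eq_zero]
  refine IsHausdorff.haus (I := I) inferInstance _ fun k => ?_
  rw [SModEq.sub_mem, smul_eq_mul, Ideal.mul_top, sub_zero]
  have h1 := Ideal.pow_le_pow_right (Nat.le_add_left k n) (hL (n + k))
  have h2 := Ideal.mul_mem_left _ (x ^ n) (ht k)
  rw [Finset.sum_range_add] at h1
  have h3 : x ^ n * ∑ i ∈ Finset.range k, x ^ i * s (n + i) =
      ∑ i ∈ Finset.range k, x ^ (n + i) * s (n + i) := by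
    rw [Finset.mul_sum]
    exact Finset.sum_congr rfl fun i _ => by rw [pow_add, mul_assoc]
  have : L - (∑ i ∈ Finset.range n, x ^ i * s i + x ^ n * t) =
      (L - (∑ i ∈ Finset.range n, x ^ i * s i + ∑ i ∈ Finset.range k, x ^ (n + i) * s (n + i))) -
        x ^ n * (t - ∑ i ∈ Finset.range k, x ^ i * s (n + i)) := by
    rw [mul_sub, h3]; ring
  rw [this]
  exact sub_mem h1 h2

/-- Nakayama's lemma over a complete ring, for a submodule that need not be finitely generated
but is `x`-adically separated. -/
theorem le_of_le_sup_smul_of_isAdicComplete (I : Ideal S) [IsAdicComplete I S] {x : S}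
    (hx : x ∈ I) {M : Type*} [AddCommGroup M] [Module S M] {N V : Submodule S M} (hN : N.FG)
    (hNV : N ≤ V) (hV : ∀ v ∈ V, ∃ n ∈ N, ∃ w ∈ V, v = n + x • w)
    (hsep : ∀ v ∈ V, (∀ n : ℕ, ∃ w ∈ V, v = x ^ n • w) → v = 0) : V ≤ N := by
  obtain ⟨r, g, hg⟩ := Submodule.fg_iff_exists_fin_generating_family.1 hN
  have hgN : ∀ j, g j ∈ N := fun j => hg ▸ Submodule.subset_span ⟨j, rfl⟩
  have hstep : ∀ v : V, ∃ (a : Fin r → S) (w : V), (v : M) = ∑ j, a j • g j + x • (w : M) := by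
    rintro ⟨v, hv⟩
    obtain ⟨n, hn, w, hw, h⟩ := hV v hv
    rw [← hg, Submodule.mem_span_range_iff_exists_fun] at hn
    obtain ⟨a, rfl⟩ := hn
    exact ⟨a, ⟨w, hw⟩, h⟩
  choose a next hnext using hstep
  intro v hv
  let seq : ℕ → V := fun n => next^[n] ⟨v, hv⟩
  have hseq : ∀ n, v = ∑ i ∈ Finset.range n, x ^ i • ∑ j, a (seq i) j • g j +
      x ^ n • (seq n : M) := by
    intro n
    induction n with
    | zero => simp [seq]
    | succ n ih =>
      have : seq (n + 1) = next (seq n) := Function.iterate_succ_apply' _ _ _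
      rw [Finset.sum_range_succ, this, add_assoc, pow_succ, mul_smul, ← smul_add, ← hnext]
      exact ih
  choose L hL using fun j => exists_adic_sum I hx fun i => a (seq i) j
  have hmem : ∑ j, L j • g j ∈ N := sum_mem fun j _ => N.smul_mem _ (hgN j)
  have : v - ∑ j, L j • g j = 0 := by
    refine hsep _ (sub_mem hv (hNV hmem)) fun n => ?_
    choose t ht using fun j => hL j n
    refine ⟨seq n - ∑ j, t j • g j, sub_mem (seq n).2
      (hNV (sum_mem fun j _ => N.smul_mem _ (hgN j))), ?_⟩
    have h1 : ∑ j, L j • g j = ∑ i ∈ Finset.range n, x ^ i • ∑ j, a (seq i) j • g j +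
        x ^ n • ∑ j, t j • g j := by
      simp_rw [Finset.smul_sum]
      rw [Finset.sum_comm, ← Finset.sum_add_distrib]
      refine Finset.sum_congr rfl fun j _ => ?_
      conv_lhs => rw [ht j]
      rw [add_smul, Finset.sum_smul, mul_smul]
      simp_rw [mul_smul]
    conv_lhs => rw [hseq n, h1]
    rw [smul_sub]
    abel
  rw [sub_eq_zero.1 this]
  exact hmem

end Complete

section Completion

variable {R : Type*} [CommRing R] [IsLocalRing R] [IsNoetherianRing R]

local notation "Rhat" => AdicCompletion (maximalIdeal R) R

theorem exists_sub_algebraMap_mem_span {x : R} {k : ℕ}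
    (hk : maximalIdeal R ^ k ≤ Ideal.span {x}) (s : Rhat) :
    ∃ r : R, s - algebraMap R Rhat r ∈ Ideal.span {algebraMap R Rhat x} := by
  obtain ⟨r, hr⟩ := Ideal.Quotient.mk_surjective (s.1 k)
  refine ⟨r, ?_⟩
  have h1 : s - algebraMap R Rhat r ∈
      (maximalIdeal R ^ k • ⊤ : Submodule R Rhat) := by
    rw [AdicCompletion.pow_smul_top_eq_ker_eval (maximalIdeal R).fg_of_isNoetherianRing,
      LinearMap.mem_ker, map_sub, sub_eq_zero]
    exact hr.symm
  rw [Ideal.smul_top_eq_map, Submodule.restrictScalars_mem] at h1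
  have := Ideal.map_mono (f := algebraMap R Rhat) hk h1
  rwa [Ideal.map_span, Set.image_singleton] at this

/-- The completion of a Noetherian local ring is Noetherian, in the case where some power of the
maximal ideal lies in a principal ideal. -/
theorem isNoetherianRing_adicCompletion {x : R} (hx : x ∈ maximalIdeal R) {k : ℕ}
    (hk : maximalIdeal R ^ k ≤ Ideal.span {x}) : IsNoetherianRing Rhat := by
  classical
  set y := algebraMap R Rhat x
  have hmax := AdicCompletion.maximalIdeal_eq_map (R := R)
  have hy : y ∈ maximalIdeal Rhat := by
    rw [hmax]; exact Ideal.mem_map_of_mem _ hx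
  have : IsNoetherianRing (Rhat ⧸ Ideal.span {y}) := by
    refine isNoetherianRing_of_surjective R _
      ((Ideal.Quotient.mk (Ideal.span {y})).comp (algebraMap R Rhat)) fun q => ?_
    obtain ⟨s, rfl⟩ := Ideal.Quotient.mk_surjective q
    obtain ⟨r, hr⟩ := exists_sub_algebraMap_mem_span hk s
    exact ⟨r, (Ideal.Quotient.mk_eq_mk_iff_sub_mem _ _).2 (by
      rw [← neg_sub]; exact neg_mem hr)⟩
  refine IsNoetherianRing.of_prime fun P hP => ?_
  by_cases hyP : y ∈ P
  · have h1 : maximalIdeal Rhat ≤ P := by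
      refine hP.le_of_pow_le (n := k) ?_
      rw [hmax, ← Ideal.map_pow]
      refine (Ideal.map_mono hk).trans ?_
      rw [Ideal.map_span, Set.image_singleton, Ideal.span_singleton_le_iff_mem]
      exact hyP
    rw [← (IsLocalRing.maximalIdeal.isMaximal _).eq_of_le hP.ne_top h1, hmax]
    exact (maximalIdeal R).fg_of_isNoetherianRing.map _
  · have hfg : (P.map (Ideal.Quotient.mk (Ideal.span {y}))).FG := IsNoetherian.noetherian _
    obtain ⟨s, hs, hspan⟩ := (Submodule.fg_span_iff_fg_span_finset_subset _).1 hfg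
    obtain ⟨t, ht, rfl⟩ := Finset.subset_set_image_iff.1 hs
    have hle : Submodule.span Rhat (t : Set Rhat) ≤ P := Submodule.span_le.2 ht
    have : P ≤ Submodule.span Rhat (t : Set Rhat) := by
      refine le_of_le_sup_smul_of_isAdicComplete (maximalIdeal Rhat) hy ⟨t, rfl⟩ hle ?_ ?_
      · intro v hv
        have h1 : Ideal.Quotient.mk (Ideal.span {y}) v ∈
            (Ideal.span (t : Set Rhat)).map (Ideal.Quotient.mk (Ideal.span {y})) := by
          rw [Ideal.map_span, ← Finset.coe_image]
          have := Ideal.mem_map_of_mem (Ideal.Quotient.mk (Ideal.span {y})) hv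
          exact hspan.le this
        rw [Ideal.mem_map_iff_of_surjective _ Ideal.Quotient.mk_surjective] at h1
        obtain ⟨n, hn, hnv⟩ := h1
        rw [Ideal.Quotient.mk_eq_mk_iff_sub_mem, Ideal.mem_span_singleton'] at hnv
        obtain ⟨w, hw⟩ := hnv
        refine ⟨n, hn, -w, ?_, by rw [smul_eq_mul]; linear_combination hw⟩
        refine neg_mem ((hP.mem_or_mem (?_ : w * y ∈ P)).resolve_right hyP)
        rw [hw]
        exact sub_mem (hle hn) hv
      · intro v _ hv
        refine IsHausdorff.haus (I := maximalIdeal Rhat) inferInstance _ fun n => ?_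
        rw [SModEq.sub_mem, smul_eq_mul, Ideal.mul_top, sub_zero]
        obtain ⟨w, -, rfl⟩ := hv n
        exact Ideal.mul_mem_right _ _ (Ideal.pow_mem_pow hy n)
    exact ⟨t, le_antisymm hle this⟩

end Completion

/-! ### Finiteness of the normalization -/

section Finiteness

/-- In a reduced Noetherian local ring of dimension at most one, with `x` in the maximal ideal
such that the maximal ideal is minimal over `x`, an element that is divisible by every power of
`x` in the normalization vanishes. -/
theorem eq_zero_of_forall_integral_div {S : Type*} [CommRing S] [IsLocalRing S]
    [IsNoetherianRing S] [IsReduced S] {x : S} (hx : x ∈ maximalIdeal S) (hx0 : x ∈ S⁰)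
    (hmin : maximalIdeal S ∈ (Ideal.span {x}).minimalPrimes) {L : Type*} [CommRing L]
    [Algebra S L] [IsLocalization.Away x L] {a : S}
    (ha : ∀ n : ℕ, ∃ z : L, IsIntegral S z ∧ algebraMap S L a = algebraMap S L x ^ n * z) :
    a = 0 := by
  by_contra ha0
  obtain ⟨P, hP, haP⟩ : ∃ P ∈ minimalPrimes S, a ∉ P := by
    by_contra! h
    have : a ∈ (⊥ : Ideal S).radical := by
      rw [← Ideal.sInf_minimalPrimes, Ideal.mem_sInf]
      exact fun {P} hP => h P hP
    obtain ⟨n, hn⟩ := this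
    exact ha0 (eq_zero_of_pow_eq_zero hn)
  have hPp : P.IsPrime := hP.isPrime
  -- every prime ideal that strictly contains `P` is the maximal ideal, which contains `x`
  obtain ⟨M, hM⟩ : x ∈ (P ⊔ Ideal.span {a}).radical := by
    rw [Ideal.radical_eq_sInf, Ideal.mem_sInf]
    rintro (q : Ideal S) ⟨hq, hqp⟩
    have hlt : P < q := lt_of_le_of_ne (le_sup_left.trans hq) fun h =>
      haP (h ▸ hq (Ideal.mem_sup_right (Ideal.mem_span_singleton_self a)))
    have hle : q ≤ maximalIdeal S := IsLocalRing.le_maximalIdeal hqp.ne_top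
    rcases hle.eq_or_lt with h | h
    · exact h ▸ hx
    · exfalso
      have h1 := Ideal.height_le_one_of_isPrincipal_of_mem_minimalPrimes _ _ hmin
      have h2 := (Ideal.height_le_iff (n := 1)).1 h1 q hqp h
      have h3 : q.height = 0 := by simpa using h2
      rw [Ideal.height_eq_zero_iff] at h3
      exact hlt.not_ge (h3.2 ⟨hPp, bot_le⟩ hlt.le)
  obtain ⟨p, hp, c, hc, hpc⟩ := Submodule.mem_sup.1 hM
  obtain ⟨b, rfl⟩ := Ideal.mem_span_singleton'.1 hc
  have hxP : x ∉ P := fun hxP => by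
    have := Ideal.disjoint_nonZeroDivisors_of_mem_minimalPrimes hP
    exact Set.disjoint_left.1 this hxP hx0
  let D := S ⧸ P
  let K := FractionRing D
  let f : S →+* K := (algebraMap D K).comp (Ideal.Quotient.mk P)
  have hf : ∀ s, f s = 0 ↔ s ∈ P := fun s => by
    rw [RingHom.comp_apply, FaithfulSMul.algebraMap_eq_zero_iff, Ideal.Quotient.eq_zero_iff_mem]
  have hfx : f x ≠ 0 := fun h => hxP ((hf x).1 h)
  let φ : L →+* K := IsLocalization.Away.lift x (g := f) (isUnit_iff_ne_zero.2 hfx)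
  have hφ : ∀ s, φ (algebraMap S L s) = f s := fun s => IsLocalization.Away.lift_eq _ _ s
  obtain ⟨z, hz, haz⟩ := ha (M + 1)
  have hz' : IsIntegral D (φ z) := by
    obtain ⟨q, hq, hqz⟩ := hz
    refine ⟨q.map (Ideal.Quotient.mk P), hq.map _, ?_⟩
    rw [Polynomial.eval₂_map]
    have : (algebraMap D K).comp (Ideal.Quotient.mk P) = φ.comp (algebraMap S L) :=
      RingHom.ext fun s => (hφ s).symm
    rw [this, ← Polynomial.hom_eval₂, hqz, map_zero]
  have h1 : f x ^ M = f b * f a := by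
    rw [← map_pow, ← hpc, map_add, (hf p).2 hp, zero_add, map_mul]
  have h2 : f a = f x ^ (M + 1) * φ z := by
    rw [← hφ, haz, map_mul, map_pow, hφ]
  have h3 : f x * (f b * φ z) = 1 := by
    refine mul_left_cancel₀ (pow_ne_zero M hfx) ?_
    rw [mul_one]
    conv_rhs => rw [h1, h2]
    ring
  -- the inverse of `x` is integral over `S / P`
  let w : integralClosure D K :=
    ⟨f b * φ z, mul_mem (algebraMap_mem _ (Ideal.Quotient.mk P b)) hz'⟩
  have h4 : IsUnit (algebraMap D (integralClosure D K) (Ideal.Quotient.mk P x)) :=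
    IsUnit.of_mul_eq_one w (Subtype.ext h3)
  have h5 : IsUnit (Ideal.Quotient.mk P x) := isUnit_of_map_unit (algebraMap D _) _ h4
  obtain ⟨u, hu⟩ := h5.exists_right_inv
  obtain ⟨u, rfl⟩ := Ideal.Quotient.mk_surjective u
  rw [← map_mul, ← map_one (Ideal.Quotient.mk P), Ideal.Quotient.mk_eq_mk_iff_sub_mem] at hu
  have h6 := IsLocalRing.le_maximalIdeal hPp.ne_top hu
  have h7 : (1 : S) ∈ maximalIdeal S := by
    have := sub_mem (Ideal.mul_mem_right u _ hx) h6
    rwa [sub_sub_cancel] at this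
  exact (Ideal.ne_top_iff_one _).1 (maximalIdeal.isMaximal S).ne_top h7

variable {R : Type*} [CommRing R] [IsNoetherianRing R]

/-- A bound of Krull–Akizuki type: up to multiples of a non-zero-divisor `x`, the normalization is
finitely generated, since `ℓ(B / x B) = ℓ(R / x R)` for all finitely generated `B`. -/
theorem exists_fg_sup_eq (hfin : ∀ a ∈ R⁰, Module.length R (R ⧸ Ideal.span {a}) ≠ ⊤)
    {x : R} (hx0 : x ∈ R⁰) :
    ∃ B : Submodule R (FractionRing R), B.FG ∧ 1 ≤ B ∧ B ≤ integralClosureInQ R ∧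
      integralClosureInQ R ≤
        Submodule.span R {algebraMap R (FractionRing R) x} * integralClosureInQ R ⊔ B := by
  set T := integralClosureInQ R
  set X := Submodule.span R {algebraMap R (FractionRing R) x}
  obtain ⟨u, hu⟩ := exists_unit_eq_algebraMap hx0
  have hX : X * Submodule.span R {((u⁻¹ : (FractionRing R)ˣ) : FractionRing R)} = 1 := by
    rw [← span_singleton_mul_inv u, hu]
  have hX1 : X ≤ 1 := by
    rw [Submodule.span_singleton_le_iff_mem]
    exact Submodule.algebraMap_mem x
  have hXle : ∀ B : Submodule R (FractionRing R), X * B ≤ B := fun B => by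
    simpa using mul_le_mul' hX1 (le_refl B)
  have hX1fin : relLength X 1 ≠ ⊤ := by
    have := hfin x hx0
    rwa [← relLength_coeSubmodule (A := FractionRing R),
      IsLocalization.coeSubmodule_span_singleton] at this
  have hT1 : 1 ≤ T := Submodule.one_le.2 (one_mem (integralClosure R (FractionRing R)))
  have hbound : ∀ B : Submodule R (FractionRing R), B.FG → 1 ≤ B → B ≤ T →
      relLength (X * T) (X * T ⊔ B) ≤ relLength X 1 := by
    intro B hB h1 hBT
    have hreg : IsRegularFractionalIdeal B :=
      ⟨FractionalIdeal.isFractional_of_fg hB, 1, Submodule.one_le.1 h1, one_mem _⟩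
    have hBfin := isRegularFractionalIdeal_one.relLength_ne_top hfin hreg h1
    have h2 : relLength X (X * B) = relLength 1 B := by
      have := relLength_mul hX h1
      rwa [mul_one] at this
    have hXB : X ≤ X * B := by simpa using mul_le_mul' (le_refl X) h1
    have h3 : relLength (X * B) B = relLength X 1 := by
      have h4 := relLength_add hXB (hXle B)
      rw [← relLength_add hX1 h1, h2, add_comm] at h4
      exact ENat.add_left_injective_of_ne_top hBfin (by simpa [add_comm] using h4)
    rw [sup_comm, ← relLength_inf, ← h3]
    exact relLength_mono (le_inf (hXle B) (mul_le_mul' le_rfl hBT)) inf_le_left le_rfl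
  by_contra! hcon
  have hgrow : ∀ n : ℕ, ∃ B : Submodule R (FractionRing R), B.FG ∧ 1 ≤ B ∧ B ≤ T ∧
      (n : ℕ∞) ≤ relLength (X * T) (X * T ⊔ B) := by
    intro n
    induction n with
    | zero => exact ⟨1, isRegularFractionalIdeal_one.fg, le_rfl, hT1, by simp⟩
    | succ n ih =>
      obtain ⟨B, hB, h1, hBT, hn⟩ := ih
      obtain ⟨t, ht, htB⟩ := SetLike.not_le_iff_exists.1 (hcon B hB h1 hBT)
      refine ⟨B ⊔ Submodule.span R {t}, hB.sup (Submodule.fg_span_singleton t),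
        h1.trans le_sup_left, sup_le hBT ((Submodule.span_singleton_le_iff_mem _ _).2 ht), ?_⟩
      rw [← relLength_add (le_sup_left : X * T ≤ X * T ⊔ B)
        (sup_le_sup le_rfl (le_sup_left : B ≤ B ⊔ Submodule.span R {t})), Nat.cast_add,
        Nat.cast_one]
      refine add_le_add hn (one_le_relLength fun hle => htB (hle ?_))
      exact (le_sup_right.trans le_sup_right : Submodule.span R {t} ≤ _)
        (Submodule.mem_span_singleton_self t)
  obtain ⟨e, he⟩ := ENat.ne_top_iff_exists.1 hX1fin
  obtain ⟨B, hB, h1, hBT, hn⟩ := hgrow (e + 1)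
  have := hn.trans (hbound B hB h1 hBT)
  rw [← he] at this
  have : e + 1 ≤ e := by exact_mod_cast this
  omega

end Finiteness

section Descent

variable {R : Type*} [CommRing R] [IsLocalRing R] [IsNoetherianRing R]

/-- Contraction of principal ideals from the completion. -/
theorem mem_span_of_algebraMap_mem_span {a r : R}
    (h : algebraMap R (AdicCompletion (maximalIdeal R) R) r ∈
      Ideal.span {algebraMap R (AdicCompletion (maximalIdeal R) R) a}) :
    r ∈ Ideal.span {a} := by
  have := Module.FaithfullyFlat.of_flat_of_isLocalHom (A := R)
    (B := AdicCompletion (maximalIdeal R) R)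
  rw [← Ideal.comap_map_eq_self_of_faithfullyFlat (B := AdicCompletion (maximalIdeal R) R)
    (Ideal.span {a}), Ideal.mem_comap, Ideal.map_span, Set.image_singleton]
  exact h

/-- The normalization of a one-dimensional analytically unramified Cohen–Macaulay local ring has a
common denominator. -/
theorem isFractional_integralClosureInQ (hdim : ringKrullDim R = 1)
    (hCM : IsCohenMacaulayLocal R) (hAU : IsAnalyticallyUnramified R) :
    IsFractional R⁰ (integralClosureInQ R) := by
  obtain ⟨x, hx, hx0⟩ := exists_mem_maximalIdeal_nonZeroDivisors hdim hCM
  let S := AdicCompletion (maximalIdeal R) R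
  let y := algebraMap R S x
  obtain ⟨k, hk⟩ : ∃ k, maximalIdeal R ^ k ≤ Ideal.span {x} :=
    Ideal.exists_pow_le_of_le_radical_of_fg
      (fun z hz => exists_pow_mem_span hdim hx0 hz) (maximalIdeal R).fg_of_isNoetherianRing
  have hSN : IsNoetherianRing S := isNoetherianRing_adicCompletion hx hk
  have hSr : IsReduced S := hAU
  have hmax : maximalIdeal S = (maximalIdeal R).map (algebraMap R S) :=
    AdicCompletion.maximalIdeal_eq_map
  have hy : y ∈ maximalIdeal S := by
    rw [hmax]; exact Ideal.mem_map_of_mem _ hx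
  have hspan : ∀ a : R, (Ideal.span {a}).map (algebraMap R S) = Ideal.span {algebraMap R S a} :=
    fun a => by rw [Ideal.map_span, Set.image_singleton]
  have hmin : maximalIdeal S ∈ (Ideal.span {y}).minimalPrimes := by
    refine ⟨⟨inferInstance, (Ideal.span_singleton_le_iff_mem _).2 hy⟩, fun q hq _ => ?_⟩
    refine hq.1.le_of_pow_le (n := k) ?_
    rw [hmax, ← Ideal.map_pow]
    exact (Ideal.map_mono hk).trans ((hspan x).le.trans hq.2)
  have hy0 : y ∈ S⁰ := by
    rw [mem_nonZeroDivisors_iff_left]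
    intro s hs
    have h1 : IsSMulRegular R x := fun a b hab =>
      (mul_cancel_left_mem_nonZeroDivisors hx0).1 hab
    have h2 : IsSMulRegular S x := h1.of_flat
    refine h2 ?_
    simpa [Algebra.smul_def] using hs
  let L := Localization.Away y
  have hyL : IsUnit (algebraMap S L y) := IsLocalization.Away.algebraMap_isUnit y
  have hSL : Function.Injective (algebraMap S L) :=
    IsLocalization.injective L (Submonoid.powers_le.2 hy0)
  let ψ : R →+* L := (algebraMap S L).comp (algebraMap R S)
  have hψ : ∀ s : R⁰, IsUnit (ψ s) := fun s => by
    obtain ⟨n, hn⟩ := exists_pow_mem_span hdim s.2 hx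
    obtain ⟨c, hc⟩ := Ideal.mem_span_singleton'.1 hn
    refine isUnit_of_mul_isUnit_right (x := ψ c) ?_
    rw [← map_mul, hc, map_pow]
    exact hyL.pow n
  let φ : FractionRing R →+* L := IsLocalization.lift hψ
  have hφ : ∀ r, φ (algebraMap R _ r) = ψ r := fun r => IsLocalization.lift_eq hψ r
  set T := integralClosureInQ R
  obtain ⟨B, hB, hB1, hBT, hTB⟩ :=
    exists_fg_sup_eq (fun a ha => length_quotient_span_ne_top hdim ha) hx0
  let V := Submodule.span S (φ '' (T : Set (FractionRing R)))
  let N := Submodule.span S (φ '' (B : Set (FractionRing R)))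
  have hsmul : ∀ (r : R) (q : FractionRing R), φ (r • q) = algebraMap R S r • φ q := fun r q => by
    rw [Algebra.smul_def, map_mul, hφ, Algebra.smul_def]
    rfl
  have hN : N.FG := by
    obtain ⟨s, rfl⟩ := hB
    classical
    refine ⟨s.image φ, le_antisymm ?_ ?_⟩
    · rw [Finset.coe_image]
      exact Submodule.span_mono (Set.image_mono Submodule.subset_span)
    · rw [Submodule.span_le, Finset.coe_image]
      rintro _ ⟨b, hb, rfl⟩
      refine Submodule.span_induction (p := fun b _ => φ b ∈ Submodule.span S (φ '' (s : Set _)))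
        ?_ ?_ ?_ ?_ hb
      · exact fun b hb => Submodule.subset_span ⟨b, hb, rfl⟩
      · rw [map_zero]; exact zero_mem _
      · intro a b _ _ ha hb
        rw [map_add]; exact add_mem ha hb
      · intro r b _ hb
        rw [hsmul]; exact Submodule.smul_mem _ _ hb
  have hNV : N ≤ V := Submodule.span_mono (Set.image_mono hBT)
  have hVint : ∀ v ∈ V, IsIntegral S v := by
    intro v hv
    have : V ≤ Subalgebra.toSubmodule (integralClosure S L) := by
      rw [Submodule.span_le]
      rintro _ ⟨t, ht, rfl⟩
      obtain ⟨q, hq, hqt⟩ : IsIntegral R t := ht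
      refine ⟨q.map (algebraMap R S), hq.map _, ?_⟩
      rw [Polynomial.eval₂_map]
      have h1 : (algebraMap S L).comp (algebraMap R S) = φ.comp (algebraMap R _) :=
        RingHom.ext fun r => (hφ r).symm
      rw [h1, ← Polynomial.hom_eval₂, hqt, map_zero]
    exact this hv
  have hstep : ∀ v ∈ V, ∃ n ∈ N, ∃ w ∈ V, v = n + y • w := by
    intro v hv
    refine Submodule.span_induction (p := fun v _ => ∃ n ∈ N, ∃ w ∈ V, v = n + y • w)
      ?_ ?_ ?_ ?_ hv
    · rintro _ ⟨t, ht, rfl⟩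
      obtain ⟨p, hp, b, hb, rfl⟩ := Submodule.mem_sup.1 (hTB ht)
      obtain ⟨t', ht', rfl⟩ := Submodule.mem_span_singleton_mul.1 hp
      refine ⟨φ b, Submodule.subset_span ⟨b, hb, rfl⟩, φ t', Submodule.subset_span ⟨t', ht', rfl⟩,
        ?_⟩
      rw [map_add, ← Algebra.smul_def, hsmul, add_comm]
    · exact ⟨0, zero_mem _, 0, zero_mem _, by simp⟩
    · rintro _ _ _ _ ⟨n, hn, w, hw, rfl⟩ ⟨n', hn', w', hw', rfl⟩
      exact ⟨n + n', add_mem hn hn', w + w', add_mem hw hw', by rw [smul_add]; abel⟩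
    · rintro s _ _ ⟨n, hn, w, hw, rfl⟩
      exact ⟨s • n, N.smul_mem _ hn, s • w, V.smul_mem _ hw, by
        rw [smul_add, smul_comm s y]⟩
  have hsep : ∀ v ∈ V, (∀ n : ℕ, ∃ w ∈ V, v = y ^ n • w) → v = 0 := by
    intro v _ hv
    obtain ⟨n, a, ha⟩ := IsLocalization.Away.surj y v
    have ha0 : a = 0 := by
      refine eq_zero_of_forall_integral_div (L := L) hy hy0 hmin fun j => ?_
      obtain ⟨w, hw, hvw⟩ := hv j
      refine ⟨y ^ n • w, hVint _ (V.smul_mem _ hw), ?_⟩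
      rw [← ha, hvw, Algebra.smul_def, Algebra.smul_def, map_pow, map_pow]
      ring
    rw [ha0, map_zero] at ha
    exact (hyL.pow n).mul_left_eq_zero.1 ha
  have hVN : V ≤ N := le_of_le_sup_smul_of_isAdicComplete (maximalIdeal S) hy hN hNV hstep hsep
  -- a common denominator of `B` is one of `T`
  obtain ⟨a, ha, haB⟩ := FractionalIdeal.isFractional_of_fg (S := R⁰) hB
  obtain ⟨j, hj⟩ := exists_pow_mem_span hdim ha hx
  obtain ⟨c, hc⟩ := Ideal.mem_span_singleton'.1 hj
  have hNint : ∀ v ∈ N, ∃ s, y ^ j • v = algebraMap S L s := by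
    intro v hv
    refine Submodule.span_induction (p := fun v _ => ∃ s, y ^ j • v = algebraMap S L s)
      ?_ ?_ ?_ ?_ hv
    · rintro _ ⟨b, hb, rfl⟩
      obtain ⟨r, hr⟩ := haB b hb
      refine ⟨algebraMap R S (c * r), ?_⟩
      have h1 : x ^ j • b = algebraMap R _ (c * r) := by
        rw [← hc, mul_smul, ← hr, map_mul, Algebra.smul_def]
      have h2 := hsmul (x ^ j) b
      rw [h1, hφ, map_pow] at h2
      exact h2.symm
    · exact ⟨0, by simp⟩
    · rintro v w _ _ ⟨s, hs⟩ ⟨t, ht⟩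
      exact ⟨s + t, by rw [smul_add, hs, ht, map_add]⟩
    · rintro s v _ ⟨t, ht⟩
      exact ⟨s * t, by rw [smul_comm, ht, map_mul, Algebra.smul_def]⟩
  refine ⟨x ^ j, pow_mem hx0 j, fun t ht => ?_⟩
  obtain ⟨s, hs⟩ := hNint _ (hVN (Submodule.subset_span ⟨t, ht, rfl⟩))
  obtain ⟨n, r, hr⟩ : ∃ (n : ℕ) (r : R), x ^ n • t = algebraMap R _ r := by
    obtain ⟨⟨r, d⟩, hd⟩ := IsLocalization.surj R⁰ t
    obtain ⟨n, hn⟩ := exists_pow_mem_span hdim d.2 hx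
    obtain ⟨e, he⟩ := Ideal.mem_span_singleton'.1 hn
    refine ⟨n, e * r, ?_⟩
    have hd' : t * algebraMap R (FractionRing R) d = algebraMap R (FractionRing R) r := hd
    rw [← he, Algebra.smul_def, map_mul, map_mul, ← hd']
    ring
  have h1 : x ^ j * r ∈ Ideal.span {x ^ n} := by
    refine mem_span_of_algebraMap_mem_span (Ideal.mem_span_singleton'.2 ⟨s, hSL ?_⟩)
    have h2 := hsmul (x ^ n) t
    rw [hr, hφ] at h2
    have h3 : algebraMap S L (algebraMap R S r) = algebraMap S L (y ^ n) * φ t := by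
      rw [← Algebra.smul_def, ← map_pow, ← h2]
      rfl
    have h4 : algebraMap S L s = algebraMap S L (y ^ j) * φ t := by rw [← hs, Algebra.smul_def]
    have h5 : ∀ i, algebraMap R S (x ^ i) = y ^ i := fun i => map_pow _ _ _
    rw [map_mul (algebraMap R S), h5, h5, map_mul, map_mul, h3, h4]
    rw [mul_right_comm, mul_assoc]
  obtain ⟨d, hd⟩ := Ideal.mem_span_singleton'.1 h1
  refine ⟨d, ?_⟩
  obtain ⟨u, hu⟩ := exists_unit_eq_algebraMap (pow_mem hx0 n)
  refine u.isUnit.mul_left_cancel ?_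
  rw [hu, ← map_mul, mul_comm, hd, map_mul, ← hr, Algebra.smul_def, Algebra.smul_def]
  ring

end Descent

/-! ### Nakayama's lemma and the determinant trick for subalgebras -/

section Subalgebra

variable {R A : Type*} [CommRing R] [CommRing A] [Algebra R A]

/-- An `R`-submodule `J` of `A` with `S J ⊆ J`, intersected with the subalgebra `S`, as an ideal of
`S`. -/
def idealOfMulLe (S : Subalgebra R A) (J : Submodule R A) (h : Subalgebra.toSubmodule S * J ≤ J) :
    Ideal S where
  carrier := {a | (a : A) ∈ J}
  add_mem' ha hb := J.add_mem ha hb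
  zero_mem' := J.zero_mem
  smul_mem' s _ ha := h (Submodule.mul_mem_mul s.2 ha)

theorem mem_idealOfMulLe {S : Subalgebra R A} {J : Submodule R A}
    {h : Subalgebra.toSubmodule S * J ≤ J} {a : S} : a ∈ idealOfMulLe S J h ↔ (a : A) ∈ J :=
  Iff.rfl

/-- Nakayama's lemma: if `C` is finitely generated and contains a unit and `C = J C` for an ideal
`J` of `S`, then `J = S`. -/
theorem one_mem_of_le_mul {S : Subalgebra R A} {J C : Submodule R A}
    (hJ : Subalgebra.toSubmodule S * J ≤ J) (hJS : J ≤ Subalgebra.toSubmodule S) (hC : C.FG)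
    (hu : ∃ u ∈ C, IsUnit u) (h : C ≤ J * C) : (1 : A) ∈ J := by
  let D : Submodule S A := Submodule.span S (C : Set A)
  have hD : D.FG := by
    obtain ⟨s, rfl⟩ := hC
    refine ⟨s, ?_⟩
    refine le_antisymm (Submodule.span_mono Submodule.subset_span) (Submodule.span_le.2 ?_)
    exact fun c hc => Submodule.span_subset_span R S _ hc
  have hle : D ≤ idealOfMulLe S J hJ • D := by
    refine Submodule.span_le.2 fun c hc => ?_
    refine Submodule.mul_induction_on (h hc) (fun j hj c hc => ?_) (fun a b ha hb => add_mem ha hb)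
    exact Submodule.smul_mem_smul (I := idealOfMulLe S J hJ) (r := ⟨j, hJS hj⟩) hj
      (Submodule.subset_span hc)
  obtain ⟨r, hr, hr0⟩ := Submodule.exists_sub_one_mem_and_smul_eq_zero_of_fg_of_le_smul _ _ hD hle
  obtain ⟨u, huC, hu⟩ := hu
  have h0 : r • u = 0 := hr0 u (Submodule.subset_span huC)
  rw [Algebra.smul_def] at h0
  have h1 : (r : A) = 0 := hu.mul_left_eq_zero.1 h0
  rw [mem_idealOfMulLe] at hr
  have := neg_mem hr
  simpa [h1] using this

/-- The determinant trick. -/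
theorem isIntegral_of_mul_le {K : Submodule R A} (hK : K.FG) (hu : ∃ u ∈ K, IsUnit u) {q : A}
    (hq : ∀ k ∈ K, q * k ∈ K) : IsIntegral R q := by
  have : Module.Finite R K := Module.Finite.iff_fg.2 hK
  let f : Module.End R K := (LinearMap.mulLeft R q).restrict hq
  obtain ⟨p, hp, hpf⟩ := Module.End.isIntegral.isIntegral f
  refine ⟨p, hp, ?_⟩
  obtain ⟨u, huK, hu⟩ := hu
  have hpow : ∀ (n : ℕ) (k : K), (((f ^ n) k : K) : A) = q ^ n * k := by
    intro n
    induction n with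
    | zero => simp
    | succ n ih =>
      intro k
      rw [pow_succ, Module.End.mul_apply, ih, pow_succ, mul_assoc]
      rfl
  have h1 : ((Polynomial.aeval f p) ⟨u, huK⟩ : K) = 0 := by
    rw [Polynomial.aeval_def, hpf]; rfl
  have h2 : (((Polynomial.aeval f p) ⟨u, huK⟩ : K) : A) = Polynomial.aeval q p * u := by
    rw [Polynomial.aeval_eq_sum_range, Polynomial.aeval_eq_sum_range, LinearMap.sum_apply,
      Finset.sum_mul, Submodule.coe_sum]
    refine Finset.sum_congr rfl fun i _ => ?_
    rw [LinearMap.smul_apply, Submodule.coe_smul, hpow, smul_mul_assoc]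
  rw [h1, Submodule.coe_zero] at h2
  rw [← Polynomial.aeval_def]
  exact hu.mul_left_eq_zero.1 h2.symm

end Subalgebra

/-! ### Avoidance of submodules over an infinite residue field -/

/-- A module over a local ring with infinite residue field is not a finite union of proper
submodules. -/
theorem exists_mem_forall_notMem {R M ι : Type*} [CommRing R] [IsLocalRing R] [AddCommGroup M]
    [Module R M] [Infinite (ResidueField R)] {V : Submodule R M} (N : ι → Submodule R M)
    (s : Finset ι) (h : ∀ i ∈ s, ¬ V ≤ N i) : ∃ y ∈ V, ∀ i ∈ s, y ∉ N i := by
  classical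
  induction s using Finset.induction_on with
  | empty => exact ⟨0, zero_mem _, by simp⟩
  | insert k s _ ih =>
    obtain ⟨y, hy, hys⟩ := ih fun i hi => h i (Finset.mem_insert_of_mem hi)
    by_cases hyk : y ∈ N k
    · obtain ⟨z, hz, hzk⟩ := SetLike.not_le_iff_exists.1 (h k (Finset.mem_insert_self _ _))
      -- on the line `z + a y` each `N i` has at most one point with given residue of `a`
      let f : ResidueField R → R := Function.surjInv residue_surjective
      have hf : ∀ a, residue R (f a) = a := Function.surjInv_eq residue_surjective
      have hbad : (⋃ i ∈ s, {a | z + f a • y ∈ N i}).Finite := by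
        refine s.finite_toSet.biUnion fun i hi => Set.Subsingleton.finite ?_
        intro a ha b hb
        by_contra hab
        have hunit : IsUnit (f a - f b) := by
          rw [← residue_ne_zero_iff_isUnit, map_sub, hf, hf]
          exact sub_ne_zero.2 hab
        have h1 : (f a - f b) • y ∈ N i := by
          have := (N i).sub_mem ha hb
          rwa [add_sub_add_left_eq_sub, ← sub_smul] at this
        obtain ⟨u, hu⟩ := hunit
        rw [← hu] at h1
        have h2 := (N i).smul_mem (↑u⁻¹ : R) h1
        rw [smul_smul, u.inv_mul, one_smul] at h2
        exact hys i hi h2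
      obtain ⟨a, ha⟩ := hbad.exists_notMem
      refine ⟨z + f a • y, add_mem hz (V.smul_mem _ hy), fun i hi => ?_⟩
      rcases Finset.mem_insert.1 hi with rfl | hi
      · exact fun hmem => hzk (((N i).add_mem_iff_left ((N i).smul_mem _ hyk)).1 hmem)
      · exact fun hmem => ha (Set.mem_biUnion (Finset.mem_coe.2 hi) hmem)
    · refine ⟨y, hy, fun i hi => ?_⟩
      rcases Finset.mem_insert.1 hi with rfl | hi
      exacts [hyk, hys i hi]

/-! ### Invertible ideals and principal reductions -/

section Normalization

variable {R : Type*} [CommRing R]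

theorem one_le_integralClosureInQ : 1 ≤ integralClosureInQ R :=
  Submodule.one_le.2 (one_mem (integralClosure R (FractionRing R)))

theorem integralClosureInQ_mul_self :
    integralClosureInQ R * integralClosureInQ R = integralClosureInQ R :=
  (integralClosure R (FractionRing R)).isIdempotentElem_toSubmodule

theorem isRegularFractionalIdeal_integralClosureInQ
    (hT : IsFractional R⁰ (integralClosureInQ R)) :
    IsRegularFractionalIdeal (integralClosureInQ R) :=
  ⟨hT, 1, Submodule.one_le.1 one_le_integralClosureInQ, one_mem _⟩

variable [IsNoetherianRing R]

theorem le_integralClosureInQ_of_mul_le {K J : Submodule R (FractionRing R)}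
    (hK : IsRegularFractionalIdeal K) (h : J * K ≤ K) : J ≤ integralClosureInQ R := fun _ hq =>
  isIntegral_of_mul_le hK.fg hK.exists_isUnit_mem fun _ hk => h (Submodule.mul_mem_mul hq hk)

/-- For a module `K` over the normalization, the ring of multipliers is the normalization. -/
theorem div_self_eq_integralClosureInQ {K : Submodule R (FractionRing R)}
    (hK : IsRegularFractionalIdeal K) (h : K * integralClosureInQ R = K) :
    K / K = integralClosureInQ R :=
  le_antisymm (le_integralClosureInQ_of_mul_le hK (Submodule.le_div_iff_mul_le.1 le_rfl))
    (Submodule.le_div_iff_mul_le.2 (by rw [mul_comm, h]))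

/-- Regular fractional ideals of the normalization `T` are invertible. With `J = I (T : I)` and the
conductor `c`, which is a canonical ideal of `T`, both `c : c J = T : J = (T : I) : (T : I)` and
`c : c` are `T`; so `c J = c` by duality, and `J = T` by Nakayama's lemma. -/
theorem mul_integralClosureInQ_div {ω : Submodule R (FractionRing R)} (hω : IsCanonicalIdeal ω)
    (hω1 : 1 ≤ ω) (hωT : ω ≤ integralClosureInQ R) (hT : IsFractional R⁰ (integralClosureInQ R))
    {I : Submodule R (FractionRing R)} (hI : IsRegularFractionalIdeal I)
    (hIT : I * integralClosureInQ R = I) :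
    I * (integralClosureInQ R / I) = integralClosureInQ R := by
  have hTT := integralClosureInQ_mul_self (R := R)
  have hT1 := one_le_integralClosureInQ (R := R)
  have hTreg := isRegularFractionalIdeal_integralClosureInQ hT
  set T := integralClosureInQ R
  have hωω : ω / ω = 1 := by
    have := hω.2 1 isRegularFractionalIdeal_one
    rwa [div_one'] at this
  set c := (1 : Submodule R (FractionRing R)) / T
  have hc : ω / T = c := div_eq_one_div hωω hω1 hωT hTT
  have hcreg : IsRegularFractionalIdeal c := isRegularFractionalIdeal_one.div hTreg
  have hdivT : ∀ K L : Submodule R (FractionRing R), L * T = L → K / L * T = K / L := by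
    intro K L hL
    refine le_antisymm ?_ (by simpa using mul_le_mul' (le_refl (K / L)) hT1)
    rw [Submodule.le_div_iff_mul_le, mul_assoc, mul_comm T, hL]
    exact Submodule.le_div_iff_mul_le.1 le_rfl
  have hcT : c * T = c := hdivT 1 T hTT
  -- the conductor is a canonical ideal of `T`
  have hdual : ∀ K : Submodule R (FractionRing R), IsRegularFractionalIdeal K → K * T = K →
      c / (c / K) = K := by
    intro K hK hKT
    have h1 : ∀ L : Submodule R (FractionRing R), L * T = L → c / L = ω / L := fun L hL => by
      rw [← hc, ← div_mul_eq, mul_comm, hL]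
    rw [h1 _ (hdivT c K hKT), h1 K hKT, hω.2 K hK]
  set J := I * (T / I) with hJ
  have hTI : IsRegularFractionalIdeal (T / I) := hTreg.div hI
  have hJreg : IsRegularFractionalIdeal J := hI.mul hTI
  have hJT : J * T = J := by rw [hJ, mul_assoc, mul_comm (T / I), ← mul_assoc, hIT]
  have hJle : J ≤ T := by
    rw [hJ, mul_comm]
    exact Submodule.le_div_iff_mul_le.1 le_rfl
  have h1 : c / (c * J) = c / c := by
    rw [div_mul_eq, div_self_eq_integralClosureInQ hcreg hcT, hJ, div_mul_eq,
      div_self_eq_integralClosureInQ hTI (hdivT T I hIT)]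
  have h2 : c * J = c := by
    rw [← hdual _ (hcreg.mul hJreg) (by rw [mul_assoc, hJT]), h1, hdual c hcreg hcT]
  have h3 : (1 : FractionRing R) ∈ J :=
    one_mem_of_le_mul (S := integralClosure R (FractionRing R)) (C := c)
      ((mul_comm _ _).le.trans hJT.le) hJle hcreg.fg hcreg.exists_isUnit_mem
      (by rw [mul_comm, h2])
  refine le_antisymm hJle ?_
  rw [← hJT]
  simpa using mul_le_mul' (Submodule.one_le.2 h3) (le_refl T)

/-- Every regular fractional ideal `V` has a principal reduction `y`: the normalization is
semilocal with invertible ideals, so any `y ∈ V` that avoids finitely many proper submodules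
generates `V T`. -/
theorem exists_mul_integralClosureInQ_eq [IsLocalRing R] [Infinite (ResidueField R)]
    {ω : Submodule R (FractionRing R)} (hω : IsCanonicalIdeal ω)
    (hω1 : 1 ≤ ω) (hωT : ω ≤ integralClosureInQ R) (hT : IsFractional R⁰ (integralClosureInQ R))
    {V : Submodule R (FractionRing R)} (hV : IsRegularFractionalIdeal V) :
    ∃ y : (FractionRing R)ˣ, (y : FractionRing R) ∈ V ∧
      V * integralClosureInQ R =
        Submodule.span R {(y : FractionRing R)} * integralClosureInQ R := by
  have hTT := integralClosureInQ_mul_self (R := R)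
  have hT1 := one_le_integralClosureInQ (R := R)
  have hTreg := isRegularFractionalIdeal_integralClosureInQ hT
  let S := integralClosure R (FractionRing R)
  set T := integralClosureInQ R
  set I := V * T with hI
  have hIT : I * T = I := by rw [hI, mul_assoc, hTT]
  have hIreg : IsRegularFractionalIdeal I := hV.mul hTreg
  have hinv : I * (T / I) = T := mul_integralClosureInQ_div hω hω1 hωT hT hIreg hIT
  have hfin : Module.Finite R S := Module.Finite.iff_fg.2 hTreg.fg
  have hmaxfin : {n : Ideal S | n.IsMaximal}.Finite := by
    refine (Algebra.QuasiFinite.finite_primesOver (S := S) (maximalIdeal R)).subset fun n hn => ?_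
    have hn' : n.IsMaximal := hn
    refine ⟨hn'.isPrime, ⟨?_⟩⟩
    exact (IsLocalRing.eq_maximalIdeal
      (Ideal.isMaximal_comap_of_isIntegral_of_isMaximal (R := R) n)).symm
  let toSub : Ideal S → Submodule R (FractionRing R) := fun n =>
    (n.restrictScalars R).map S.val.toLinearMap
  have hmem : ∀ (n : Ideal S) (a : S), (a : FractionRing R) ∈ toSub n ↔ a ∈ n := by
    intro n a
    constructor
    · rintro ⟨b, hb, hba⟩
      rwa [← Subtype.ext hba]
    · exact fun ha => ⟨a, ha, rfl⟩
  have hTsub : ∀ n : Ideal S, T * toSub n ≤ toSub n := by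
    intro n
    rw [Submodule.mul_le]
    rintro t ht _ ⟨b, hb, rfl⟩
    exact (hmem n (⟨t, ht⟩ * b)).2 (n.mul_mem_left _ hb)
  obtain ⟨y, hyV, hy⟩ := exists_mem_forall_notMem (V := V) (fun n : Ideal S => toSub n / (T / I))
    hmaxfin.toFinset (by
      intro n hn hle
      rw [Set.Finite.mem_toFinset] at hn
      rw [Submodule.le_div_iff_mul_le] at hle
      have h1 : T ≤ toSub n := by
        refine hinv.ge.trans ?_
        have h2 : I * (T / I) = T * (V * (T / I)) := by rw [← mul_assoc, mul_comm T, hI]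
        exact h2.le.trans ((mul_le_mul' le_rfl hle).trans (hTsub n))
      exact (Ideal.ne_top_iff_one n).1 (Ideal.IsMaximal.ne_top hn)
        ((hmem n 1).1 (h1 (one_mem S))))
  set Y := Submodule.span R {y}
  have hYV : Y ≤ V := (Submodule.span_singleton_le_iff_mem _ _).2 hyV
  have hTK : T * (Y * (T / I)) ≤ Y * (T / I) := by
    rw [mul_left_comm]
    refine mul_le_mul' le_rfl ?_
    rw [Submodule.le_div_iff_mul_le, mul_assoc]
    exact (mul_le_mul' le_rfl (Submodule.le_div_iff_mul_le.1 le_rfl)).trans hTT.le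
  have hK1 : (1 : FractionRing R) ∈ Y * (T / I) := by
    by_contra h1
    obtain ⟨n, hn, hle⟩ := Ideal.exists_le_maximal (idealOfMulLe S (Y * (T / I)) hTK)
      ((Ideal.ne_top_iff_one _).2 h1)
    refine hy n (by simpa using hn) (Submodule.mem_div_iff_forall_mul_mem.2 fun z hz => ?_)
    have h2 : y * z ∈ Y * (T / I) :=
      Submodule.mul_mem_mul (Submodule.mem_span_singleton_self y) hz
    have h3 : y * z ∈ T := by
      have h4 : Y * (T / I) ≤ T := by
        have h5 : V ≤ I := by simpa using mul_le_mul' (le_refl V) hT1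
        exact (mul_le_mul' (hYV.trans h5) le_rfl).trans hinv.le
      exact h4 h2
    exact (hmem n ⟨y * z, h3⟩).2 (hle h2)
  have hIY : I = Y * T := by
    refine le_antisymm ?_ (mul_le_mul' hYV le_rfl)
    have := mul_le_mul' (Submodule.one_le.2 hK1) (le_refl I)
    rwa [one_mul, mul_assoc, mul_comm _ I, hinv] at this
  obtain ⟨q, hq, hqu⟩ := hIreg.exists_isUnit_mem
  rw [hIY] at hq
  obtain ⟨t, -, rfl⟩ := Submodule.mem_span_singleton_mul.1 hq
  have hyu : IsUnit y := isUnit_of_mul_isUnit_left hqu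
  exact ⟨hyu.unit, hyV, hIY⟩

end Normalization

/-! ### The embedding dimension as a length -/

section EmbeddingDimension

variable {R : Type*} [CommRing R] [IsLocalRing R] [IsNoetherianRing R]

theorem relLength_sq_maximalIdeal :
    relLength (maximalIdeal R * maximalIdeal R) (maximalIdeal R) = embeddingDim R := by
  have h : Submodule.comap (maximalIdeal R).subtype (maximalIdeal R * maximalIdeal R) =
      maximalIdeal R • (⊤ : Submodule R (maximalIdeal R)) := by
    refine Submodule.map_injective_of_injective (maximalIdeal R).injective_subtype ?_
    rw [Submodule.map_comap_subtype, Submodule.map_smul'', Submodule.map_subtype_top, smul_eq_mul,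
      inf_eq_right]
    exact Ideal.mul_le_right
  rw [relLength, h, embeddingDim, spanFinrank_maximalIdeal_eq_finrank_cotangentSpace]
  change Module.length R (CotangentSpace R) = _
  rw [Module.length_eq_of_surjective (S := R) (R := ResidueField R) residue_surjective,
    Module.length_eq_finrank]

theorem le_of_le_sup_sq {N : Ideal R} (h : maximalIdeal R ≤ N ⊔ maximalIdeal R * maximalIdeal R) :
    maximalIdeal R ≤ N :=
  Submodule.le_of_le_smul_of_le_jacobson_bot (maximalIdeal R).fg_of_isNoetherianRing
    (maximalIdeal_le_jacobson _) h

theorem one_add_relLength_span_sup_le {x : R} (hx : x ∈ maximalIdeal R)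
    (hx2 : x ∉ maximalIdeal R * maximalIdeal R) :
    1 + relLength (Ideal.span {x} ⊔ maximalIdeal R * maximalIdeal R) (maximalIdeal R) ≤
      embeddingDim R := by
  rw [← relLength_sq_maximalIdeal, ← relLength_add
    (le_sup_right : _ ≤ Ideal.span {x} ⊔ maximalIdeal R * maximalIdeal R)
    (sup_le ((Ideal.span_singleton_le_iff_mem _).2 hx) Ideal.mul_le_right)]
  gcongr
  exact one_le_relLength fun h => hx2 (h (Ideal.mem_sup_left (Ideal.mem_span_singleton_self x)))

theorem maximalIdeal_eq_span_singleton {x : R} (hx : x ∈ maximalIdeal R)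
    (hx2 : x ∉ maximalIdeal R * maximalIdeal R) (h : embeddingDim R ≤ 1) :
    maximalIdeal R = Ideal.span {x} := by
  refine le_antisymm (le_of_le_sup_sq ?_) ((Ideal.span_singleton_le_iff_mem _).2 hx)
  have h1 : 1 + relLength (Ideal.span {x} ⊔ maximalIdeal R * maximalIdeal R) (maximalIdeal R) ≤
      1 + 0 := (one_add_relLength_span_sup_le hx hx2).trans (by exact_mod_cast h)
  exact relLength_eq_zero_iff.1 (by simpa using (ENat.add_le_add_iff_left ENat.one_ne_top).1 h1)

theorem exists_maximalIdeal_eq_span_pair {x : R} (hx : x ∈ maximalIdeal R)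
    (hx2 : x ∉ maximalIdeal R * maximalIdeal R) (h : embeddingDim R ≤ 2) :
    ∃ z ∈ maximalIdeal R, maximalIdeal R = Ideal.span {x, z} := by
  set K := Ideal.span {x} ⊔ maximalIdeal R * maximalIdeal R with hK
  have hKm : K ≤ maximalIdeal R :=
    sup_le ((Ideal.span_singleton_le_iff_mem _).2 hx) Ideal.mul_le_right
  have h1 : relLength K (maximalIdeal R) ≤ 1 := by
    have h2 : 1 + relLength K (maximalIdeal R) ≤ 1 + 1 :=
      (one_add_relLength_span_sup_le hx hx2).trans (by rw [one_add_one_eq_two]; exact_mod_cast h)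
    exact (ENat.add_le_add_iff_left ENat.one_ne_top).1 h2
  obtain ⟨z, hz, hzK⟩ : ∃ z ∈ maximalIdeal R, maximalIdeal R ≤ K ⊔ Ideal.span {z} := by
    by_cases hle : maximalIdeal R ≤ K
    · exact ⟨0, zero_mem _, hle.trans le_sup_left⟩
    · obtain ⟨z, hz, hzK⟩ := SetLike.not_le_iff_exists.1 hle
      refine ⟨z, hz, relLength_eq_zero_iff.1 ?_⟩
      have hzm := (Ideal.span_singleton_le_iff_mem _).2 hz
      have h3 : 1 ≤ relLength K (K ⊔ Ideal.span {z}) := one_le_relLength fun hle' =>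
        hzK (hle' (Ideal.mem_sup_right (Ideal.mem_span_singleton_self z)))
      rw [← relLength_add (le_sup_left : K ≤ K ⊔ Ideal.span {z}) (sup_le hKm hzm)] at h1
      have h4 := (add_le_add h3 le_rfl).trans (h1.trans_eq (add_zero 1).symm)
      simpa using (ENat.add_le_add_iff_left ENat.one_ne_top).1 h4
  refine ⟨z, hz, le_antisymm (le_of_le_sup_sq ?_) ?_⟩
  · refine hzK.trans (le_of_eq ?_)
    rw [hK, Ideal.span_insert, sup_right_comm]
  · rw [Ideal.span_le, Set.insert_subset_iff, Set.singleton_subset_iff]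
    exact ⟨hx, hz⟩

end EmbeddingDimension

/-! ### Hilbert–Samuel multiplicity of the conductor -/

section Multiplicity

theorem relLength_pow_mul {R A : Type*} [CommRing R] [CommRing A] [Algebra R A]
    {T Y Y' : Submodule R A} (hY : Y * Y' = 1) (hYT : Y * T ≤ T) (n : ℕ) :
    Y ^ n * T ≤ T ∧ relLength (Y ^ n * T) T = n * relLength (Y * T) T := by
  induction n with
  | zero => simp [relLength_self]
  | succ n ih =>
    have h1 : Y ^ (n + 1) * T = Y ^ n * (Y * T) := by rw [pow_succ, mul_assoc]
    have h2 : Y ^ n * (Y * T) ≤ Y ^ n * T := mul_le_mul' le_rfl hYT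
    refine ⟨h1 ▸ h2.trans ih.1, ?_⟩
    have h3 : Y ^ n * Y' ^ n = 1 := by rw [← mul_pow, hY, one_pow]
    rw [h1, ← relLength_add h2 ih.1, relLength_mul h3 hYT, ih.2, Nat.cast_succ]
    ring

/-- If `𝔠 = Y T` with `Y` invertible, then `ℓ(R / 𝔠 ^ n) = n ℓ(T / 𝔠) - ℓ(T / R)` for `n ≥ 1`. -/
theorem isHilbertSamuelMultiplicity_of_coeSubmodule_eq {R A : Type*} [CommRing R] [CommRing A]
    [Algebra R A] [FaithfulSMul R A] (hdim : ringKrullDim R = 1) {𝔠 : Ideal R}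
    {T Y Y' : Submodule R A} (hY : Y * Y' = 1) (hT1 : 1 ≤ T) (hTT : T * T = T)
    (h𝔠 : IsLocalization.coeSubmodule A 𝔠 = Y * T) {e d : ℕ} (he : relLength (Y * T) T = e)
    (hd : relLength 1 T = d) : IsHilbertSamuelMultiplicity 𝔠 e := by
  have hYT1 : Y * T ≤ 1 := by
    rw [← h𝔠, ← IsLocalization.coeSubmodule_top]
    exact IsLocalization.coeSubmodule_mono A le_top
  have hlen : ∀ n : ℕ, n ≠ 0 → Module.length R (R ⧸ 𝔠 ^ n) + d = n * e := by
    intro n hn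
    have h1 : ∀ k : ℕ, IsLocalization.coeSubmodule A (𝔠 ^ (k + 1)) = Y ^ (k + 1) * T := by
      intro k
      induction k with
      | zero => simpa using h𝔠
      | succ k ih =>
        rw [pow_succ 𝔠, IsLocalization.coeSubmodule_mul, ih, h𝔠, mul_mul_mul_comm, hTT, ← pow_succ]
    obtain ⟨k, rfl⟩ := Nat.exists_eq_succ_of_ne_zero hn
    have h2 := relLength_pow_mul hY (hYT1.trans hT1) (k + 1)
    have h3 : Y ^ (k + 1) * T ≤ 1 := by
      rw [← h1, ← IsLocalization.coeSubmodule_top]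
      exact IsLocalization.coeSubmodule_mono A le_top
    rw [← relLength_coeSubmodule (A := A), h1, ← hd, relLength_add h3 hT1, h2.2, he]
  have hfin : ∀ n : ℕ, Module.length R (R ⧸ 𝔠 ^ n) ≠ ⊤ := by
    intro n
    rcases eq_or_ne n 0 with rfl | hn
    · have : Subsingleton (R ⧸ 𝔠 ^ 0) := by
        rw [pow_zero, Ideal.one_eq_top]
        exact Ideal.Quotient.subsingleton_iff.2 rfl
      rw [Module.length_eq_zero]
      exact ENat.zero_ne_top
    · intro htop
      have := hlen n hn
      rw [htop, top_add] at this
      exact (ENat.natCast_ne_top (n * e)) (by rw [Nat.cast_mul]; exact this.symm)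
  refine ⟨1, by exact_mod_cast hdim, hfin, ?_⟩
  have hlim : Filter.Tendsto (fun n : ℕ => (e : ℝ) - d / n) Filter.atTop (nhds (e : ℝ)) := by
    simpa using tendsto_const_nhds.sub (tendsto_const_div_atTop_nhds_zero_nat (d : ℝ))
  refine hlim.congr' ?_
  filter_upwards [Filter.eventually_ne_atTop 0] with n hn
  obtain ⟨l, hl⟩ := ENat.ne_top_iff_exists.1 (hfin n)
  have h1 := hlen n hn
  rw [← hl] at h1 ⊢
  have h2 : (l : ℝ) + d = n * e := by exact_mod_cast h1
  have h3 : (n : ℝ) ≠ 0 := Nat.cast_ne_zero.2 hn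
  rw [ENat.toNat_natCast, Nat.factorial_one, Nat.cast_one, pow_one, one_mul]
  field_simp
  linarith

end Multiplicity

/-! ### The inequality -/

section Main

theorem coeSubmodule_conductorIdeal {R : Type*} [CommRing R] :
    IsLocalization.coeSubmodule (FractionRing R) (conductorIdeal R) =
      1 / integralClosureInQ R := by
  refine Submodule.map_comap_eq_of_le ?_
  rw [← Submodule.one_eq_range]
  have := div_le_div_left' (I := 1) (one_le_integralClosureInQ (R := R))
  rwa [div_one'] at this

variable {R : Type*} [CommRing R] [IsLocalRing R] [IsNoetherianRing R]

/-- An almost Gorenstein ring with infinite residue field and finite normalization `T` satisfies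
the ideal arithmetic of `AlmostGorensteinFrame`, and its conductor is principal in `T`. -/
theorem exists_almostGorensteinFrame (hdim : ringKrullDim R = 1)
    (hCM : IsCohenMacaulayLocal R) (hAU : IsAnalyticallyUnramified R)
    (hres : Infinite (ResidueField R)) (hAG : IsAlmostGorenstein R) :
    ∃ (ω X' Y Y' : Submodule R (FractionRing R)) (x : R), x ∈ maximalIdeal R ∧ x ∈ R⁰ ∧
      AlmostGorensteinFrame (integralClosureInQ R) (1 / integralClosureInQ R) ω
        (IsLocalization.coeSubmodule (FractionRing R) (maximalIdeal R))
        (Submodule.span R {algebraMap R (FractionRing R) x}) X' ∧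
      Y * Y' = 1 ∧ 1 / integralClosureInQ R = Y * integralClosureInQ R := by
  obtain ⟨ω, hω, hω1, hωT, hωm⟩ := hAG
  have hT := isFractional_integralClosureInQ hdim hCM hAU
  have hTT := integralClosureInQ_mul_self (R := R)
  have hT1 := one_le_integralClosureInQ (R := R)
  have hTreg := isRegularFractionalIdeal_integralClosureInQ hT
  have hcreg : IsRegularFractionalIdeal (1 / integralClosureInQ R) :=
    isRegularFractionalIdeal_one.div hTreg
  set 𝔪 := IsLocalization.coeSubmodule (FractionRing R) (maximalIdeal R)
  have h𝔪1 : 𝔪 ≤ 1 := by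
    rw [← IsLocalization.coeSubmodule_top]
    exact IsLocalization.coeSubmodule_mono _ le_top
  have h𝔪reg : IsRegularFractionalIdeal 𝔪 := by
    obtain ⟨x, hx, hx0⟩ := exists_mem_maximalIdeal_nonZeroDivisors hdim hCM
    refine isRegularFractionalIdeal_iff.2 ⟨⟨1, one_mem _, ?_⟩, x, hx0, ?_⟩
    · rwa [map_one, ← Submodule.one_eq_span, one_mul]
    · exact (Submodule.span_singleton_le_iff_mem _ _).2 ⟨x, hx, rfl⟩
  obtain ⟨u, hu𝔪, hu⟩ := exists_mul_integralClosureInQ_eq hω hω1 hωT hT h𝔪reg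
  obtain ⟨v, -, hv⟩ := exists_mul_integralClosureInQ_eq hω hω1 hωT hT hcreg
  obtain ⟨x, hx, hxu⟩ := hu𝔪
  have hxu' : algebraMap R (FractionRing R) x = u := hxu
  have hx0 : x ∈ R⁰ := by
    rw [mem_nonZeroDivisors_iff_right]
    intro r hr
    have : algebraMap R (FractionRing R) r * u = 0 := by rw [← hxu', ← map_mul, hr, map_zero]
    rwa [u.mul_left_eq_zero, FaithfulSMul.algebraMap_eq_zero_iff] at this
  have hnot : ¬ 1 ≤ Submodule.span R {algebraMap R (FractionRing R) x} *
      integralClosureInQ R := by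
    intro h
    obtain ⟨t, ht, hxt⟩ := Submodule.mem_span_singleton_mul.1 (Submodule.one_le.1 h)
    have h1 : IsUnit (algebraMap R (integralClosure R (FractionRing R)) x) :=
      IsUnit.of_mul_eq_one (⟨t, ht⟩ : integralClosure R (FractionRing R)) (Subtype.ext hxt)
    have : FaithfulSMul R (integralClosure R (FractionRing R)) :=
      (faithfulSMul_iff_algebraMap_injective _ _).2 fun a b hab =>
        FaithfulSMul.algebraMap_injective R (FractionRing R) (congrArg Subtype.val hab)
    exact (mem_maximalIdeal x).1 hx (isUnit_of_map_unit _ _ h1)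
  have F : AlmostGorensteinFrame (integralClosureInQ R) (1 / integralClosureInQ R) ω 𝔪
      (Submodule.span R {algebraMap R (FractionRing R) x})
      (Submodule.span R {((u⁻¹ : (FractionRing R)ˣ) : FractionRing R)}) :=
    { one_le := hω1
      le := hωT
      mul_self := hTT
      conductor := rfl
      dual := fun K h h' => hω.2 K (hcreg.of_le_of_le hTreg h h')
      mul_omega := by rw [mul_comm]; exact Submodule.le_div_iff_mul_le.1 hωm
      mul_inv := by rw [hxu', span_singleton_mul_inv]
      X_le := (Submodule.span_singleton_le_iff_mem _ _).2 ⟨x, hx, rfl⟩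
      mul_T := by rw [hu, hxu']
      le_one := h𝔪1
      le_of_lt := by
        intro K hK hK1 q hq
        obtain ⟨r, rfl⟩ := Submodule.mem_one.1 (hK hq)
        refine ⟨r, ?_, rfl⟩
        by_contra hr
        obtain ⟨w, rfl⟩ := not_not.1 fun h => hr ((mem_maximalIdeal r).2 h)
        refine hK1 (Submodule.one_le.2 ?_)
        have := K.smul_mem (↑w⁻¹ : R) hq
        rwa [Algebra.smul_def, ← map_mul, w.inv_mul, map_one] at this
      not_one_le := hnot
      finite := by
        have h1 : 1 / integralClosureInQ R ≤ 1 := by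
          have := div_le_div_left' (I := 1) hT1
          rwa [div_one'] at this
        exact hcreg.relLength_ne_top (fun a ha => length_quotient_span_ne_top hdim ha) hTreg
          (h1.trans hT1) }
  refine ⟨ω, _, _, _, x, hx, hx0, F, span_singleton_mul_inv v, ?_⟩
  rw [← hv, F.c_mul_T]

/-- The inequality `ℓ(T / c) ≤ ν ℓ(R / c)`. With `n = ℓ(R / c)` and `τ = ℓ(ω / R)` the left side is
`2 n + τ`, and `τ + 3 ≤ n + ν` suffices as soon as `ν ≥ 3`. -/
theorem AlmostGorensteinFrame.relLength_le_embeddingDim_mul (hdim : ringKrullDim R = 1)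
    {T c ω X' Y Y' : Submodule R (FractionRing R)} {x : R} (hx : x ∈ maximalIdeal R)
    (hx0 : x ∈ R⁰)
    (F : AlmostGorensteinFrame T c ω
      (IsLocalization.coeSubmodule (FractionRing R) (maximalIdeal R))
      (Submodule.span R {algebraMap R (FractionRing R) x}) X')
    (hY : Y * Y' = 1) (hc : c = Y * T) {e n : ℕ} (he : relLength c T = e)
    (hn : relLength c 1 = n) : e ≤ embeddingDim R * n := by
  set 𝔪 := IsLocalization.coeSubmodule (FractionRing R) (maximalIdeal R)
  set X := Submodule.span R {algebraMap R (FractionRing R) x}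
  by_cases h1 : 1 ≤ c
  · have hTc : T ≤ c := by
      have := mul_le_mul' h1 (le_refl T)
      rwa [one_mul, F.c_mul_T] at this
    have : (e : ℕ∞) = 0 := by rw [← he, relLength_eq_zero_iff.2 hTc]
    have : e = 0 := by exact_mod_cast this
    omega
  have hν : relLength (𝔪 * 𝔪) 𝔪 = embeddingDim R := by
    rw [← relLength_sq_maximalIdeal, ← IsLocalization.coeSubmodule_mul]
    exact relLength_map Ideal.mul_le_right (FaithfulSMul.algebraMap_injective R _)
  have hn1 : 1 ≤ n := by
    have := one_le_relLength h1
    rw [hn] at this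
    exact_mod_cast this
  by_cases hcm : c = 𝔪
  · have h2 := F.relLength_m_T hcm
    rw [he, hν] at h2
    have h3 : e = embeddingDim R := by exact_mod_cast h2
    rw [h3]
    exact Nat.le_mul_of_pos_right _ hn1
  obtain ⟨τ, hτ⟩ : ∃ τ : ℕ, relLength 1 ω = τ := by
    have h2 : relLength 1 ω ≤ e := he ▸ relLength_mono F.c_le_one F.one_le F.le
    obtain ⟨τ, hτ⟩ := ENat.ne_top_iff_exists.1 (ne_top_of_le_ne_top (ENat.natCast_ne_top e) h2)
    exact ⟨τ, hτ.symm⟩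
  have he2 : e = n + τ + n := by
    have := F.relLength_c_T
    rw [he, hn, hτ] at this
    exact_mod_cast this
  have hx2 : x ∉ maximalIdeal R * maximalIdeal R := by
    intro h
    refine F.not_one_le ?_
    have h2 : X ≤ 𝔪 * 𝔪 := by
      rw [← IsLocalization.coeSubmodule_mul]
      exact (Submodule.span_singleton_le_iff_mem _ _).2 ⟨x, h, rfl⟩
    have h3 : X ≤ X * (X * T) := by
      refine h2.trans ((mul_le_mul' F.m_le_mul_T F.m_le_mul_T).trans (le_of_eq ?_))
      rw [mul_mul_mul_comm, F.mul_self, mul_assoc]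
    rwa [le_mul_iff_of_mul_eq_one F.mul_inv, mul_comm, F.mul_inv] at h3
  have hν2 : 2 ≤ embeddingDim R := by
    by_contra hlt
    refine F.m_ne_X h1 hY hc ?_
    exact (congrArg (IsLocalization.coeSubmodule (FractionRing R))
      (maximalIdeal_eq_span_singleton hx hx2 (by omega))).trans
      (IsLocalization.coeSubmodule_span_singleton _ x)
  rcases hν2.eq_or_lt with hν2 | hν3
  · obtain ⟨z, hz, hm⟩ := exists_maximalIdeal_eq_span_pair hx hx2 hν2.ge
    have hω1 := F.omega_eq_one hm (exists_pow_mem_span hdim hx0 hz)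
    have hτ0 : τ = 0 := by
      rw [hω1, relLength_self] at hτ
      exact_mod_cast hτ.symm
    rw [← hν2, he2, hτ0]
    omega
  · have h2 := F.relLength_one_omega_add_three_le h1 hcm
    rw [hτ, hn, hν] at h2
    have h3 : τ + 3 ≤ n + embeddingDim R := by exact_mod_cast h2
    obtain ⟨m, hm⟩ := Nat.exists_eq_add_of_le hν3
    rw [hm] at h3 ⊢
    rw [he2]
    have : m ≤ m * n := Nat.le_mul_of_pos_right _ hn1
    nlinarith

end Main

end WilfAG

theorem theorem2p1 (R : Type*) [CommRing R] [IsLocalRing R] [IsNoetherianRing R]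
    (hdim : ringKrullDim R = 1)
    (hCM : WilfAG.IsCohenMacaulayLocal R)
    (hAU : WilfAG.IsAnalyticallyUnramified R)
    (hres : Infinite (IsLocalRing.ResidueField R))
    (hAG : WilfAG.IsAlmostGorenstein R) :
    ∃ e l : ℕ, WilfAG.IsHilbertSamuelMultiplicity (WilfAG.conductorIdeal R) e ∧
      Module.length R (R ⧸ WilfAG.conductorIdeal R) = (l : ℕ∞) ∧
      e ≤ WilfAG.embeddingDim R * l := by
  obtain ⟨ω, X', Y, Y', x, hx, hx0, F, hY, hc⟩ :=
    WilfAG.exists_almostGorensteinFrame hdim hCM hAU hres hAG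
  have hmono : ∀ {J I : Submodule R (FractionRing R)}, 1 / WilfAG.integralClosureInQ R ≤ J →
      J ≤ I → I ≤ WilfAG.integralClosureInQ R → ∃ k : ℕ, WilfAG.relLength J I = k := by
    intro J I h h' h''
    obtain ⟨k, hk⟩ := ENat.ne_top_iff_exists.1
      (ne_top_of_le_ne_top F.finite (WilfAG.relLength_mono h h' h''))
    exact ⟨k, hk.symm⟩
  obtain ⟨e, he⟩ := hmono le_rfl (F.c_le_one.trans F.one_le_T) le_rfl
  obtain ⟨l, hl⟩ := hmono le_rfl F.c_le_one F.one_le_T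
  obtain ⟨d, hd⟩ := hmono F.c_le_one F.one_le_T le_rfl
  refine ⟨e, l, ?_, ?_, F.relLength_le_embeddingDim_mul hdim hx hx0 hY hc he hl⟩
  · exact WilfAG.isHilbertSamuelMultiplicity_of_coeSubmodule_eq hdim hY F.one_le_T F.mul_self
      (WilfAG.coeSubmodule_conductorIdeal.trans hc) (hc ▸ he) hd
  · rw [← WilfAG.relLength_coeSubmodule (A := FractionRing R), WilfAG.coeSubmodule_conductorIdeal,
      hl]
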